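/- Let $\mathbb{D}$ be the open unit disk of $\mathbb{C}$, $\mathbb{T}$ the unit circle and $m$ the normalised Lebesgue measure on $\mathbb{T}$. For $1\le p<\infty$ let $H^p$ be the space of analytic functions $f:\mathbb{D}\to\mathbb{C}$ with $$\|f\|_p=\sup_{0<r<1}\Big(\int_{\mathbb{T}}|f(r\zeta)|^p\,dm(\zeta)\Big)^{1/p}<\infty,$$ and let $H^\infty$ be the space of bounded analytic functions on $\mathbb{D}$ with the norm $\|f\|_\infty=\sup_{z\in\mathbb{D}}|f(z)|$. The essential norm of a bounded operator $T:X\to Y$ is $$\|T\|_e=\inf\{\|T-K\| : K \text{ is a compact operator from } X \text{ to } Y\}.$$ Let $1\le p<\infty$, let $u$ be an analytic function on $\mathbb{D}$ and let $\varphi:\mathbb{D}\to\mathbb{D}$ be analytic with $\|\varphi\|_\infty=1$. Suppose that the weighted composition operator $uC_\varphi:f\mapsto u\cdot(f\circ\varphi)$ is a bounded operator from $H^p$ to $H^\infty$, and set $$M_\varphi(u)=\limsup_{|\varphi(z)|\to1}\frac{|u(z)|}{(1-|\varphi(z)|^2)^{1/p}},\qquad z\in\mathbb{D}.$$ Then $$\tfrac12\,M_\varphi(u)\le\|uC_\varphi\|_e\le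 2\,M_\varphi(u),$$ and, if $p>1$, moreover $M_\varphi(u)\le\|uC_\varphi\|_e$. -/

import Mathlib

open Set Filter Topology MeasureTheory
open scoped ENNReal

noncomputable section

/-- The analytic functions on the open unit disk, each one represented by its extension by `0`
to `ℂ`, so that two elements are equal exactly when they agree on the disk. -/
def diskAnalytic : Submodule ℂ (ℂ → ℂ) where
  carrier := {f | DifferentiableOn ℂ f (Metric.ball 0 1) ∧ ∀ z ∉ Metric.ball (0 : ℂ) 1, f z = 0}
  add_mem' := fun {f g} hf hg =>
    ⟨hf.1.add hg.1, fun z hz => by simp [hf.2 z hz, hg.2 z hz]⟩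
  zero_mem' := ⟨differentiableOn_const 0, fun _ _ => rfl⟩
  smul_mem' := fun c f hf => ⟨hf.1.const_smul c, fun z hz => by simp [hf.2 z hz]⟩

/-- The integral mean `(∫_𝕋 |f(rζ)|^p dm(ζ))^{1/p}`, where `m` is the normalised Lebesgue measure
on the unit circle. -/
def hardyMean (p : ℝ) (f : ℂ → ℂ) (r : ℝ) : ℝ :=
  (Real.circleAverage (fun z => ‖f z‖ ^ p) 0 r) ^ (1 / p)

/-- `‖f‖_p = sup_{0 < r < 1} (∫_𝕋 |f(rζ)|^p dm(ζ))^{1/p}`. -/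
def hardyNorm (p : ℝ) (f : ℂ → ℂ) : ℝ := ⨆ r : Ioo (0 : ℝ) 1, hardyMean p f r

/-- The supremum `sup_{z ∈ 𝔻} |f(z)|`. -/
def diskSupNorm (f : ℂ → ℂ) : ℝ := ⨆ z : Metric.ball (0 : ℂ) 1, ‖f z‖

lemma hardyMean_nonneg (p : ℝ) (f : ℂ → ℂ) (r : ℝ) : 0 ≤ hardyMean p f r := by
  unfold hardyMean Real.circleAverage
  apply Real.rpow_nonneg
  apply smul_nonneg (by positivity)
  exact intervalIntegral.integral_nonneg (by positivity) fun _ _ => by positivity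

lemma continuous_circle_of_diskAnalytic {f : ℂ → ℂ} (hf : f ∈ diskAnalytic) {r : ℝ}
    (hr : r ∈ Ioo (0 : ℝ) 1) : Continuous fun θ : ℝ => f (circleMap 0 r θ) := by
  refine hf.1.continuousOn.comp_continuous (continuous_circleMap 0 r) fun θ => ?_
  simp [abs_of_pos hr.1, hr.2]

/-- The normalised Lebesgue measure on `(0, 2π]`. -/
def normAngle : Measure ℝ :=
  (ENNReal.ofReal (2 * Real.pi)⁻¹) • (volume.restrict (Ioc 0 (2 * Real.pi)))

lemma memLp_normAngle {g : ℝ → ℂ} (hg : Continuous g) (p : ℝ≥0∞) : MemLp g p normAngle := by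
  refine MemLp.smul_measure ?_ ENNReal.ofReal_ne_top
  obtain ⟨C, hC⟩ := (isCompact_Icc (a := (0 : ℝ)) (b := 2 * Real.pi)).exists_bound_of_continuousOn
    hg.continuousOn
  refine MemLp.of_bound hg.aestronglyMeasurable C ?_
  exact (ae_restrict_iff' measurableSet_Ioc).2 (ae_of_all _ fun x hx => hC x ⟨hx.1.le, hx.2⟩)

lemma eLpNorm_circle {p : ℝ} (hp : 1 ≤ p) {f : ℂ → ℂ} (hf : f ∈ diskAnalytic) {r : ℝ}
    (hr : r ∈ Ioo (0 : ℝ) 1) :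
    eLpNorm (fun θ : ℝ => f (circleMap 0 r θ)) (ENNReal.ofReal p) normAngle
      = ENNReal.ofReal (hardyMean p f r) := by
  have hp0 : 0 < p := by linarith
  rw [(memLp_normAngle (continuous_circle_of_diskAnalytic hf hr) _).eLpNorm_eq_integral_rpow_norm
    (by simpa using hp0) ENNReal.ofReal_ne_top]
  rw [ENNReal.toReal_ofReal hp0.le, hardyMean, Real.circleAverage, normAngle,
    integral_smul_measure, intervalIntegral.integral_of_le (by positivity),
    ENNReal.toReal_ofReal (by positivity), one_div]

lemma hardyMean_add_le {p : ℝ} (hp : 1 ≤ p) {f g : ℂ → ℂ} (hf : f ∈ diskAnalytic)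
    (hg : g ∈ diskAnalytic) {r : ℝ} (hr : r ∈ Ioo (0 : ℝ) 1) :
    hardyMean p (f + g) r ≤ hardyMean p f r + hardyMean p g r := by
  have h := eLpNorm_add_le (μ := normAngle) (p := ENNReal.ofReal p)
    (continuous_circle_of_diskAnalytic hf hr).aestronglyMeasurable
    (continuous_circle_of_diskAnalytic hg hr).aestronglyMeasurable (by simpa using hp)
  have h2 := eLpNorm_circle hp (add_mem hf hg) hr
  rw [eLpNorm_circle hp hf hr, eLpNorm_circle hp hg hr,
    ← ENNReal.ofReal_add (hardyMean_nonneg _ _ _) (hardyMean_nonneg _ _ _)] at h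
  have h3 : ENNReal.ofReal (hardyMean p (f + g) r)
      ≤ ENNReal.ofReal (hardyMean p f r + hardyMean p g r) := by
    rw [← h2]; exact h
  exact (ENNReal.ofReal_le_ofReal_iff
    (add_nonneg (hardyMean_nonneg _ _ _) (hardyMean_nonneg _ _ _))).1 h3

lemma hardyMean_smul {p : ℝ} (hp : 1 ≤ p) (c : ℂ) {f : ℂ → ℂ} (hf : f ∈ diskAnalytic) {r : ℝ}
    (hr : r ∈ Ioo (0 : ℝ) 1) : hardyMean p (c • f) r = ‖c‖ * hardyMean p f r := by
  have h2 := eLpNorm_circle hp (diskAnalytic.smul_mem c hf) hr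
  have h : eLpNorm (fun θ : ℝ => (c • f) (circleMap 0 r θ)) (ENNReal.ofReal p) normAngle
      = ‖c‖ₑ * eLpNorm (fun θ : ℝ => f (circleMap 0 r θ)) (ENNReal.ofReal p) normAngle :=
    eLpNorm_const_smul c (fun θ : ℝ => f (circleMap 0 r θ)) _ _
  rw [h2, eLpNorm_circle hp hf hr, ← ofReal_norm, ← ENNReal.ofReal_mul (norm_nonneg c)] at h
  exact (ENNReal.ofReal_eq_ofReal_iff (hardyMean_nonneg _ _ _)
    (mul_nonneg (norm_nonneg _) (hardyMean_nonneg _ _ _))).1 h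

lemma eqOn_of_hardyMean_eq_zero {p : ℝ} (hp : 1 ≤ p) {f : ℂ → ℂ} (hf : f ∈ diskAnalytic)
    (h : ∀ r ∈ Ioo (0 : ℝ) 1, hardyMean p f r = 0) : f = 0 := by
  have hp0 : ENNReal.ofReal p ≠ 0 := by simp; linarith
  have key : ∀ r ∈ Ioo (0 : ℝ) 1, ∀ θ ∈ Icc (0 : ℝ) (2 * Real.pi), f (circleMap 0 r θ) = 0 := by
    intro r hr
    have hc := continuous_circle_of_diskAnalytic hf hr
    have h1 := eLpNorm_circle hp hf hr
    rw [h r hr, ENNReal.ofReal_zero, eLpNorm_eq_zero_iff hc.aestronglyMeasurable hp0, normAngle,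
      Measure.ae_ennreal_smul_measure_eq (by simp [Real.pi_pos])] at h1
    have h3 : (fun θ : ℝ => f (circleMap 0 r θ))
        =ᵐ[volume.restrict (Icc 0 (2 * Real.pi))] fun _ => 0 := by
      rw [← restrict_Ioc_eq_restrict_Icc]; exact h1
    exact Measure.eqOn_Icc_of_ae_eq volume (by positivity) h3 hc.continuousOn continuousOn_const
  have hz : ∀ z ∈ Metric.ball (0 : ℂ) 1, z ≠ 0 → f z = 0 := by
    intro z hz hz0
    have hr : ‖z‖ ∈ Ioo (0 : ℝ) 1 := ⟨norm_pos_iff.2 hz0, by simpa using hz⟩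
    have hmem : z ∈ circleMap 0 ‖z‖ '' Ioc 0 (2 * Real.pi) := by
      rw [image_circleMap_Ioc]; simp
    obtain ⟨θ, hθ, hθz⟩ := hmem
    rw [← hθz]
    exact key _ hr θ ⟨hθ.1.le, hθ.2⟩
  funext z
  by_cases hb : z ∈ Metric.ball (0 : ℂ) 1
  · by_cases h0 : z = 0
    · subst h0
      have hcont : ContinuousAt f 0 :=
        (hf.1.continuousOn).continuousAt (Metric.ball_mem_nhds 0 one_pos)
      have h1 : Tendsto f (𝓝[≠] 0) (𝓝 (f 0)) := hcont.tendsto.mono_left nhdsWithin_le_nhds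
      have h2 : Tendsto f (𝓝[≠] 0) (𝓝 0) := by
        refine tendsto_const_nhds.congr' ?_
        filter_upwards [self_mem_nhdsWithin,
          nhdsWithin_le_nhds (Metric.ball_mem_nhds (0 : ℂ) one_pos)] with w hw hw'
        exact (hz w hw' hw).symm
      exact tendsto_nhds_unique h1 h2
    · exact hz z hb h0
  · exact hf.2 z hb

/-- The functions of `H^p(𝔻)`: analytic on the disk with bounded integral means. -/
def hardySubmodule (p : ℝ) [hp : Fact (1 ≤ p)] : Submodule ℂ (ℂ → ℂ) where
  carrier := {f | f ∈ diskAnalytic ∧ BddAbove (range fun r : Ioo (0 : ℝ) 1 => hardyMean p f r)}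
  add_mem' := by
    rintro f g ⟨hf, A, hA⟩ ⟨hg, B, hB⟩
    refine ⟨add_mem hf hg, A + B, ?_⟩
    rintro _ ⟨r, rfl⟩
    exact (hardyMean_add_le hp.out hf hg r.2).trans (add_le_add (hA ⟨r, rfl⟩) (hB ⟨r, rfl⟩))
  zero_mem' := by
    refine ⟨zero_mem _, 0, ?_⟩
    rintro _ ⟨r, rfl⟩
    have h := hardyMean_smul hp.out 0 (zero_mem diskAnalytic) r.2
    simp only [zero_smul, norm_zero, zero_mul] at h
    exact h.le
  smul_mem' := by
    rintro c f ⟨hf, A, hA⟩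
    refine ⟨diskAnalytic.smul_mem c hf, ‖c‖ * A, ?_⟩
    rintro _ ⟨r, rfl⟩
    have h := hardyMean_smul hp.out c hf r.2
    exact h.le.trans (mul_le_mul_of_nonneg_left (hA ⟨r, rfl⟩) (norm_nonneg c))

/-- The Hardy space `H^p(𝔻)`, `1 ≤ p < ∞`, with the norm `hardyNorm p`. -/
def HardySpace (p : ℝ) [Fact (1 ≤ p)] : Type := hardySubmodule p

namespace HardySpace

variable {p : ℝ} [hp : Fact (1 ≤ p)]

instance : AddCommGroup (HardySpace p) := inferInstanceAs (AddCommGroup (hardySubmodule p))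

instance : Module ℂ (HardySpace p) := inferInstanceAs (Module ℂ (hardySubmodule p))

instance : CoeFun (HardySpace p) fun _ => ℂ → ℂ := ⟨fun f => f.1⟩

instance : Norm (HardySpace p) := ⟨fun f => hardyNorm p f⟩

lemma normedSpaceCore : NormedSpace.Core ℂ (HardySpace p) where
  norm_nonneg f := Real.iSup_nonneg fun r => hardyMean_nonneg p f r
  norm_smul c f := by
    change (⨆ r : Ioo (0 : ℝ) 1, hardyMean p (c • f.1) r) = ‖c‖ * ⨆ r : Ioo (0 : ℝ) 1, _
    rw [Real.mul_iSup_of_nonneg (norm_nonneg c)]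
    exact iSup_congr fun r => hardyMean_smul hp.out c f.2.1 r.2
  norm_triangle f g := by
    have : Nonempty (Ioo (0 : ℝ) 1) := ⟨⟨1 / 2, by norm_num, by norm_num⟩⟩
    refine ciSup_le fun r => ?_
    exact (hardyMean_add_le hp.out f.2.1 g.2.1 r.2).trans
      (add_le_add (le_ciSup f.2.2 r) (le_ciSup g.2.2 r))
  norm_eq_zero_iff f := by
    constructor
    · intro h
      refine Subtype.ext (eqOn_of_hardyMean_eq_zero hp.out f.2.1 fun r hr => ?_)
      refine le_antisymm ?_ (hardyMean_nonneg p f r)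
      exact (le_ciSup f.2.2 ⟨r, hr⟩).trans h.le
    · rintro rfl
      change (⨆ r : Ioo (0 : ℝ) 1, hardyMean p (0 : ℂ → ℂ) r) = 0
      have h : ∀ r : Ioo (0 : ℝ) 1, hardyMean p (0 : ℂ → ℂ) r = 0 := fun r => by
        have h := hardyMean_smul hp.out 0 (zero_mem diskAnalytic) r.2
        simpa using h
      simp [h]

instance : NormedAddCommGroup (HardySpace p) := NormedAddCommGroup.ofCore normedSpaceCore

instance : NormedSpace ℂ (HardySpace p) := NormedSpace.ofCore normedSpaceCore

end HardySpace

/-- The functions of `H^∞(𝔻)`: bounded analytic functions on the disk. -/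
def hInftySubmodule : Submodule ℂ (ℂ → ℂ) where
  carrier := {f | f ∈ diskAnalytic ∧ BddAbove (range fun z : Metric.ball (0 : ℂ) 1 => ‖f z‖)}
  add_mem' := by
    rintro f g ⟨hf, A, hA⟩ ⟨hg, B, hB⟩
    refine ⟨add_mem hf hg, A + B, ?_⟩
    rintro _ ⟨z, rfl⟩
    exact (norm_add_le _ _).trans (add_le_add (hA ⟨z, rfl⟩) (hB ⟨z, rfl⟩))
  zero_mem' := ⟨zero_mem _, 0, by rintro _ ⟨z, rfl⟩; simp⟩
  smul_mem' := by
    rintro c f ⟨hf, A, hA⟩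
    refine ⟨diskAnalytic.smul_mem c hf, ‖c‖ * A, ?_⟩
    rintro _ ⟨z, rfl⟩
    exact (norm_smul c (f z)).le.trans (mul_le_mul_of_nonneg_left (hA ⟨z, rfl⟩) (norm_nonneg c))

/-- The space `H^∞(𝔻)` of bounded analytic functions, with the supremum norm on the disk. -/
def HInfty : Type := hInftySubmodule

namespace HInfty

instance : AddCommGroup HInfty := inferInstanceAs (AddCommGroup hInftySubmodule)

instance : Module ℂ HInfty := inferInstanceAs (Module ℂ hInftySubmodule)

instance : CoeFun HInfty fun _ => ℂ → ℂ := ⟨fun f => f.1⟩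

instance : Norm HInfty := ⟨fun f => diskSupNorm f⟩

lemma normedSpaceCore : NormedSpace.Core ℂ HInfty where
  norm_nonneg f := Real.iSup_nonneg fun _ => norm_nonneg _
  norm_smul c f := by
    change (⨆ z : Metric.ball (0 : ℂ) 1, ‖c • f z‖) = ‖c‖ * ⨆ z : Metric.ball (0 : ℂ) 1, _
    rw [Real.mul_iSup_of_nonneg (norm_nonneg c)]
    exact iSup_congr fun z => norm_smul _ _
  norm_triangle f g := by
    have : Nonempty (Metric.ball (0 : ℂ) 1) := ⟨⟨0, by simp⟩⟩
    refine ciSup_le fun z => ?_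
    exact (norm_add_le _ _).trans (add_le_add (le_ciSup f.2.2 z) (le_ciSup g.2.2 z))
  norm_eq_zero_iff f := by
    constructor
    · intro h
      refine Subtype.ext (funext fun z => ?_)
      by_cases hz : z ∈ Metric.ball (0 : ℂ) 1
      · exact norm_le_zero_iff.1 ((le_ciSup f.2.2 ⟨z, hz⟩).trans h.le)
      · exact f.2.1.2 z hz
    · rintro rfl
      change (⨆ z : Metric.ball (0 : ℂ) 1, ‖(0 : ℂ)‖) = 0
      simp

instance : NormedAddCommGroup HInfty := NormedAddCommGroup.ofCore normedSpaceCore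

instance : NormedSpace ℂ HInfty := NormedSpace.ofCore normedSpaceCore

end HInfty

/-- The essential norm of a bounded operator: its distance to the compact operators. -/
def essentialNorm {X Y : Type*} [NormedAddCommGroup X] [NormedSpace ℂ X]
    [NormedAddCommGroup Y] [NormedSpace ℂ Y] (T : X →L[ℂ] Y) : ℝ :=
  sInf {c : ℝ | ∃ K : X →L[ℂ] Y, IsCompactOperator K ∧ c = ‖T - K‖}

/-- `M_φ(u) = limsup_{|φ(z)| → 1} |u(z)| / (1 - |φ(z)|²)^{1/p}`, with `z` in the unit disk, as an
element of `[0, ∞]`. -/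
def weightLimsup (p : ℝ) (u φ : ℂ → ℂ) : ℝ≥0∞ :=
  limsup (fun z => ENNReal.ofReal (‖u z‖ / (1 - ‖φ z‖ ^ 2) ^ (1 / p)))
    (comap (fun z => ‖φ z‖) (𝓝 1) ⊓ 𝓟 (Metric.ball 0 1))

end

/-! Everything rests on the sharp growth estimate |f(w)| ≤ ‖f‖ (1 - |w|²)^{-1/p}
(`HardySpace.norm_apply_le`) and on the kernels k_w = ((1 - |w|²)/(1 - conj w · z)²)^{1/p}, which
lie in the unit ball of H^p and attain the bound at w. Thus |u(z)| / (1 - |φ(z)|²)^{1/p} is exactly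
|(T k_{φ(z)})(z)|.

Upper bound: compare T with the finite rank operator f ↦ u · (S_N f)(rφ), where S_N is a Taylor
truncation. Where |φ| ≤ s, the value S_N f(rφ) is uniformly close to f(φ) and u = T1 is bounded.
Where |φ| > s, both f(φ) and f(rφ) obey the growth estimate at φ; these two terms give the factor 2.

Lower bound: choose z_n with |φ(z_n)| → 1 along which the quotient stays above c, and put f_n =
k_{φ(z_n)}. For compact K, a subsequence of K f_n converges to some y. If p > 1, then y = 0, so ‖(T
- K) f_n‖ is at least c - o(1). Instead of duality, a Banach–Saks argument is used: far-out kernels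
are almost uncorrelated, so suitable averages of them are small in H^p
(`exists_norm_sum_kernel_le`), while K sends these averages close to y. If p = 1, y need not vanish,
and differences f_n - f_m of norm at most 2 are used: y cancels, T f_m (z_n) → 0 as m → ∞, and a
factor 1/2 is lost. -/

/-! ### Circle averages and means of the Cauchy kernel. -/

lemma continuous_comp_circleMap {E : Type*} [TopologicalSpace E] {F : ℂ → E} {r : ℝ} (hr : 0 ≤ r)
    (hF : ContinuousOn F (Metric.sphere 0 r)) : Continuous fun θ : ℝ => F (circleMap 0 r θ) :=
  hF.comp_continuous (continuous_circleMap 0 r) fun θ => circleMap_mem_sphere 0 hr θ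

lemma norm_circleAverage_le {E : Type*} [NormedAddCommGroup E] [NormedSpace ℝ E] (F : ℂ → E)
    (c : ℂ) (r : ℝ) :
    ‖Real.circleAverage F c r‖ ≤ Real.circleAverage (fun z => ‖F z‖) c r := by
  rw [Real.circleAverage, Real.circleAverage, norm_smul, smul_eq_mul, Real.norm_of_nonneg
    (by positivity)]
  gcongr
  exact intervalIntegral.norm_integral_le_integral_norm (by positivity)

lemma circleAverage_eq_integral_normAngle (F : ℂ → ℝ) (r : ℝ) :
    Real.circleAverage F 0 r = ∫ θ, F (circleMap 0 r θ) ∂normAngle := by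
  rw [Real.circleAverage, normAngle, integral_smul_measure,
    intervalIntegral.integral_of_le (by positivity), ENNReal.toReal_ofReal (by positivity)]

lemma circleAverage_mono' {F G : ℂ → ℝ} {r : ℝ} (hr : 0 ≤ r)
    (hF : ContinuousOn F (Metric.sphere 0 r)) (hG : ContinuousOn G (Metric.sphere 0 r))
    (h : ∀ z ∈ Metric.sphere (0 : ℂ) r, F z ≤ G z) :
    Real.circleAverage F 0 r ≤ Real.circleAverage G 0 r :=
  Real.circleAverage_mono (hF.circleIntegrable hr) (hG.circleIntegrable hr)
    fun z hz => h z (by rwa [abs_of_nonneg hr] at hz)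

lemma circleAverage_congr' {E : Type*} [NormedAddCommGroup E] [NormedSpace ℝ E] {F G : ℂ → E}
    {r : ℝ} (hr : 0 ≤ r) (h : ∀ z ∈ Metric.sphere (0 : ℂ) r, F z = G z) :
    Real.circleAverage F 0 r = Real.circleAverage G 0 r :=
  Real.circleAverage_congr_sphere fun z hz => h z (by rwa [abs_of_nonneg hr] at hz)

lemma circleAverage_const_mul (c : ℝ) (F : ℂ → ℝ) (r : ℝ) :
    Real.circleAverage (fun z => c * F z) 0 r = c * Real.circleAverage F 0 r :=
  Real.circleAverage_fun_smul (a := c)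

/-- Hölder's inequality for circle averages, in the form of logarithmic convexity. -/
lemma circleAverage_rpow_mul_rpow_le {F G : ℂ → ℝ} {r t : ℝ} (hr : 0 ≤ r)
    (hF : ContinuousOn F (Metric.sphere 0 r)) (hG : ContinuousOn G (Metric.sphere 0 r))
    (hF0 : ∀ z, 0 ≤ F z) (hG0 : ∀ z, 0 ≤ G z) (ht : 0 < t) (ht1 : t < 1) :
    Real.circleAverage (fun z => F z ^ t * G z ^ (1 - t)) 0 r
      ≤ Real.circleAverage F 0 r ^ t * Real.circleAverage G 0 r ^ (1 - t) := by
  have hFc : Continuous fun θ : ℝ => F (circleMap 0 r θ) ^ t :=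
    (continuous_comp_circleMap hr hF).rpow_const fun _ => Or.inr ht.le
  have hGc : Continuous fun θ : ℝ => G (circleMap 0 r θ) ^ (1 - t) :=
    (continuous_comp_circleMap hr hG).rpow_const fun _ => Or.inr (by linarith)
  have mem : ∀ {H : ℝ → ℝ} (q : ℝ≥0∞), Continuous H → MemLp H q normAngle := fun {H} q hH => by
    have := memLp_normAngle (Complex.continuous_ofReal.comp hH) q
    exact (memLp_congr_norm hH.aestronglyMeasurable
      (Complex.continuous_ofReal.comp hH).aestronglyMeasurable
      (ae_of_all _ fun x => by simp)).2 this
  have hpq : (1 / t).HolderConjugate (1 / (1 - t)) := by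
    rw [Real.holderConjugate_iff]
    refine ⟨by rw [lt_div_iff₀ ht]; linarith, by simp⟩
  have h := integral_mul_le_Lp_mul_Lq_of_nonneg (μ := normAngle) hpq
    (ae_of_all _ fun θ => Real.rpow_nonneg (hF0 (circleMap 0 r θ)) t)
    (ae_of_all _ fun θ => Real.rpow_nonneg (hG0 (circleMap 0 r θ)) (1 - t))
    (mem _ hFc) (mem _ hGc)
  have e1 : ∀ x : ℝ, 0 ≤ x → (x ^ t) ^ (1 / t) = x := fun x hx => by
    rw [← Real.rpow_mul hx, mul_one_div_cancel ht.ne', Real.rpow_one]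
  have e2 : ∀ x : ℝ, 0 ≤ x → (x ^ (1 - t)) ^ (1 / (1 - t)) = x := fun x hx => by
    rw [← Real.rpow_mul hx, mul_one_div_cancel (by linarith), Real.rpow_one]
  simp only [one_div, inv_inv] at h
  simp only [circleAverage_eq_integral_normAngle]
  convert h using 2
  · simp only [← one_div, e1 _ (hF0 _)]
  · simp only [← one_div, e2 _ (hG0 _)]

/-- Cauchy's formula on a circle centred at the origin, with the Cauchy kernel written in terms of
`conj z`. -/
lemma circleAverage_div_one_sub_mul_conj {F : ℂ → ℂ} {r : ℝ} (hr : 0 < r)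
    (hF : DifferentiableOn ℂ F (Metric.closedBall 0 r)) {a : ℂ} (ha : ‖a‖ * r < 1) :
    Real.circleAverage (fun z => F z / (1 - a * (starRingEnd ℂ) z)) 0 r = F (a * r ^ 2) := by
  have hd : DiffContOnCl ℂ F (Metric.ball 0 |r|) := by
    rw [abs_of_pos hr]; exact hF.diffContOnCl_ball subset_rfl
  have hw : a * r ^ 2 ∈ Metric.ball (0 : ℂ) |r| := by
    simp only [mem_ball_zero_iff, norm_mul, norm_pow, Complex.norm_real, Real.norm_eq_abs,
      abs_of_pos hr]
    nlinarith
  rw [← hd.circleAverage_smul_div hw]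
  refine circleAverage_congr' hr.le fun z hz => ?_
  have hz' : ‖z‖ = r := by simpa using hz
  have hz0 : z ≠ 0 := by rw [← norm_pos_iff, hz']; exact hr
  -- On the circle z · conj z = r², which turns the usual Cauchy kernel at the point a r² into the
  -- conjugate form.
  have h1 : z - a * r ^ 2 = z * (1 - a * (starRingEnd ℂ) z) := by
    have := Complex.mul_conj' z
    rw [hz'] at this
    linear_combination a * this
  rw [h1, sub_zero, smul_eq_mul, ← div_div, div_self hz0]
  ring

lemma one_sub_conj_mul_re_pos {a z : ℂ} (h : ‖a‖ * ‖z‖ < 1) :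
    0 < (1 - (starRingEnd ℂ) a * z).re := by
  have := Complex.re_le_norm ((starRingEnd ℂ) a * z)
  rw [norm_mul, Complex.norm_conj] at this
  simp only [Complex.sub_re, Complex.one_re]
  linarith

lemma one_sub_conj_mul_mem_slitPlane {a z : ℂ} (h : ‖a‖ * ‖z‖ < 1) :
    1 - (starRingEnd ℂ) a * z ∈ Complex.slitPlane := Or.inl (one_sub_conj_mul_re_pos h)

lemma norm_one_sub_conj_mul_pos {a z : ℂ} (h : ‖a‖ * ‖z‖ < 1) :
    0 < ‖1 - (starRingEnd ℂ) a * z‖ :=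
  norm_pos_iff.2 (Complex.slitPlane_ne_zero (one_sub_conj_mul_mem_slitPlane h))

lemma differentiableOn_one_sub_conj_mul_cpow {a : ℂ} {S : Set ℂ} (h : ∀ z ∈ S, ‖a‖ * ‖z‖ < 1)
    (b : ℂ) : DifferentiableOn ℂ (fun z => (1 - (starRingEnd ℂ) a * z) ^ b) S := fun z hz =>
  (DifferentiableAt.cpow_const (f := fun z => 1 - (starRingEnd ℂ) a * z) (by fun_prop)
    (one_sub_conj_mul_mem_slitPlane (h z hz))).differentiableWithinAt

lemma continuousOn_norm_one_sub_conj_mul_rpow {a : ℂ} {S : Set ℂ} (h : ∀ z ∈ S, ‖a‖ * ‖z‖ < 1)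
    (b : ℝ) : ContinuousOn (fun z => ‖1 - (starRingEnd ℂ) a * z‖ ^ b) S :=
  ContinuousOn.rpow_const (by fun_prop) fun z hz => Or.inl (norm_one_sub_conj_mul_pos (h z hz)).ne'

lemma circleAverage_ofReal (F : ℂ → ℝ) (c : ℂ) (r : ℝ) :
    Real.circleAverage (fun z => (F z : ℂ)) c r = (Real.circleAverage F c r : ℝ) := by
  rw [Real.circleAverage, Real.circleAverage, intervalIntegral.integral_ofReal]
  simp

/-- The integral mean of the squared Cauchy kernel. -/
lemma circleAverage_norm_one_sub_rpow_neg_two {a : ℂ} {r : ℝ} (hr : 0 < r) (ha : ‖a‖ * r < 1) :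
    Real.circleAverage (fun z => ‖1 - (starRingEnd ℂ) a * z‖ ^ (-2 : ℝ)) 0 r
      = (1 - ‖a‖ ^ 2 * r ^ 2)⁻¹ := by
  have hS : ∀ z ∈ Metric.closedBall (0 : ℂ) r, ‖a‖ * ‖z‖ < 1 := fun z hz =>
    (mul_le_mul_of_nonneg_left (by simpa using hz) (norm_nonneg a)).trans_lt ha
  -- Cauchy's formula for F(z) = (1 - conj a · z)⁻¹: the integrand F(z) / (1 - a · conj z) is then
  -- the squared modulus of F.
  have h := circleAverage_div_one_sub_mul_conj hr
    (differentiableOn_one_sub_conj_mul_cpow hS (-1)) ha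
  have h2 : Real.circleAverage (fun z => (1 - (starRingEnd ℂ) a * z) ^ (-1 : ℂ) /
      (1 - a * (starRingEnd ℂ) z)) 0 r = Real.circleAverage
      (fun z => ((‖1 - (starRingEnd ℂ) a * z‖ ^ (-2 : ℝ) : ℝ) : ℂ)) 0 r := by
    congr 1
    funext z
    have h3 : 1 - a * (starRingEnd ℂ) z = (starRingEnd ℂ) (1 - (starRingEnd ℂ) a * z) := by simp
    rw [h3, Complex.cpow_neg_one, Real.rpow_neg (norm_nonneg _), div_eq_mul_inv, ← mul_inv,
      Complex.mul_conj']
    norm_cast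
  rw [h2, circleAverage_ofReal, Complex.cpow_neg_one, ← mul_assoc, Complex.conj_mul'] at h
  exact_mod_cast h

/-- Small negative powers of `1 - conj a * z` have bounded integral means. -/
lemma circleAverage_norm_one_sub_rpow_neg_le {a : ℂ} {r b : ℝ} (hr : 0 < r) (ha : ‖a‖ * r < 1)
    (hb : 0 < b) (hb1 : b < 1) :
    Real.circleAverage (fun z => ‖1 - (starRingEnd ℂ) a * z‖ ^ (-b)) 0 r
      ≤ (Real.cos (b * (Real.pi / 2)))⁻¹ := by
  have hS : ∀ z ∈ Metric.closedBall (0 : ℂ) r, ‖a‖ * ‖z‖ < 1 := fun z hz =>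
    (mul_le_mul_of_nonneg_left (by simpa using hz) (norm_nonneg a)).trans_lt ha
  have hS' : ∀ z ∈ Metric.sphere (0 : ℂ) r, ‖a‖ * ‖z‖ < 1 := fun z hz =>
    hS z (Metric.sphere_subset_closedBall hz)
  have hcos : 0 < Real.cos (b * (Real.pi / 2)) := Real.cos_pos_of_mem_Ioo
    ⟨by nlinarith [Real.pi_pos], by nlinarith [Real.pi_pos]⟩
  have hd := differentiableOn_one_sub_conj_mul_cpow hS ((-b : ℝ) : ℂ)
  have hmv : Real.circleAverage (fun z => (1 - (starRingEnd ℂ) a * z) ^ ((-b : ℝ) : ℂ)) 0 r = 1 := by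
    have h1 : DiffContOnCl ℂ (fun z => (1 - (starRingEnd ℂ) a * z) ^ ((-b : ℝ) : ℂ))
        (Metric.ball 0 |r|) := by
      rw [abs_of_pos hr]; exact hd.diffContOnCl_ball subset_rfl
    rw [h1.circleAverage]; simp
  have hc : ContinuousOn (fun z => (1 - (starRingEnd ℂ) a * z) ^ ((-b : ℝ) : ℂ))
      (Metric.sphere 0 r) := hd.continuousOn.mono Metric.sphere_subset_closedBall
  -- The real part of the holomorphic power averages to its value 1 at the origin. It dominates
  -- cos(bπ/2) times the modulus, because 1 - conj a · z lies in the right half-plane and so has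
  -- argument at most π/2 in absolute value.
  have hre : Real.circleAverage
      (fun z => ((1 - (starRingEnd ℂ) a * z) ^ ((-b : ℝ) : ℂ)).re) 0 r = 1 := by
    have := Complex.reCLM.circleAverage_comp_comm (hc.circleIntegrable hr.le)
    rw [hmv] at this
    simpa [Function.comp_def] using this
  rw [← one_div, le_div_iff₀ hcos, mul_comm, ← circleAverage_const_mul, ← hre]
  refine circleAverage_mono' hr.le
    ((continuousOn_norm_one_sub_conj_mul_rpow hS' _).const_mul _ )
    (Complex.continuous_re.comp_continuousOn hc) fun z hz => ?_
  have hx := one_sub_conj_mul_re_pos (hS' z hz)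
  set x := 1 - (starRingEnd ℂ) a * z
  have hx0 : x ≠ 0 := fun h => by simp [h] at hx
  have harg : |x.arg| ≤ Real.pi / 2 := (Complex.abs_arg_le_pi_div_two_iff).2 hx.le
  have : x ^ ((-b : ℝ) : ℂ) = ((‖x‖ ^ (-b) : ℝ) : ℂ) * Complex.exp ((-b * x.arg : ℝ) * Complex.I) := by
    rw [Complex.cpow_def_of_ne_zero hx0, Complex.log, add_mul, Complex.exp_add,
      Real.rpow_def_of_pos (norm_pos_iff.2 hx0)]
    push_cast
    congr 2
    ring
  rw [this, Complex.re_ofReal_mul, Complex.exp_ofReal_mul_I_re, mul_comm]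
  gcongr
  rw [← Real.cos_abs (-b * x.arg), abs_mul, abs_neg, abs_of_pos hb]
  exact Real.cos_le_cos_of_nonneg_of_le_pi (by positivity) (by nlinarith [Real.pi_pos])
    (by gcongr)

/-! ### Pointwise evaluation in H^∞ and H^p, and the growth estimate. -/

lemma HInfty.norm_apply_le (g : HInfty) (z : ℂ) : ‖g z‖ ≤ ‖g‖ := by
  by_cases hz : z ∈ Metric.ball (0 : ℂ) 1
  · exact le_ciSup g.2.2 ⟨z, hz⟩
  · rw [g.2.1.2 z hz, norm_zero]; exact norm_nonneg g

lemma HInfty.norm_le {g : HInfty} {C : ℝ} (h : ∀ z ∈ Metric.ball (0 : ℂ) 1, ‖g z‖ ≤ C) :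
    ‖g‖ ≤ C :=
  have : Nonempty (Metric.ball (0 : ℂ) 1) := ⟨⟨0, by simp⟩⟩
  ciSup_le fun z => h z z.2

lemma HInfty.sub_apply (f g : HInfty) (z : ℂ) : (f - g) z = f z - g z := rfl

lemma HInfty.smul_apply (c : ℂ) (f : HInfty) (z : ℂ) : (c • f) z = c * f z := rfl

lemma HInfty.sum_apply {ι : Type*} (s : Finset ι) (f : ι → HInfty) (z : ℂ) :
    (∑ i ∈ s, f i) z = ∑ i ∈ s, f i z := by
  classical
  induction s using Finset.induction_on with
  | empty => rfl
  | insert a s ha ih => rw [Finset.sum_insert ha, Finset.sum_insert ha, ← ih]; rfl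

lemma mem_diskAnalytic_indicator {f : ℂ → ℂ} (hf : DifferentiableOn ℂ f (Metric.ball 0 1)) :
    (Metric.ball (0 : ℂ) 1).indicator f ∈ diskAnalytic :=
  ⟨hf.congr fun _ hz => indicator_of_mem hz f, fun _ hz => indicator_of_notMem hz f⟩

lemma sphere_subset_ball_zero_one {r : ℝ} (hr : r ∈ Ioo (0 : ℝ) 1) :
    Metric.sphere (0 : ℂ) r ⊆ Metric.ball 0 1 := fun z hz => by
  simp only [mem_sphere_iff_norm, sub_zero, mem_ball_zero_iff] at hz ⊢
  linarith [hr.2]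

lemma hardyMean_le_iff {p : ℝ} (hp : 0 < p) (f : ℂ → ℂ) (r : ℝ) {C : ℝ} (hC : 0 ≤ C) :
    hardyMean p f r ≤ C ↔ Real.circleAverage (fun z => ‖f z‖ ^ p) 0 r ≤ C ^ p := by
  have h0 : 0 ≤ Real.circleAverage (fun z => ‖f z‖ ^ p) 0 r :=
    Real.circleAverage_nonneg_of_nonneg fun _ _ => by positivity
  rw [hardyMean, one_div]
  exact Real.rpow_inv_le_iff_of_pos h0 hC hp

namespace HardySpace

variable {p : ℝ} [hp : Fact (1 ≤ p)]

lemma pos_exponent : 0 < p := lt_of_lt_of_le one_pos hp.out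

lemma sum_apply {ι : Type*} (s : Finset ι) (f : ι → HardySpace p) (z : ℂ) :
    (∑ i ∈ s, f i) z = ∑ i ∈ s, f i z := by
  classical
  induction s using Finset.induction_on with
  | empty => rfl
  | insert a s ha ih => rw [Finset.sum_insert ha, Finset.sum_insert ha, ← ih]; rfl

lemma hardyMean_le_norm (f : HardySpace p) {r : ℝ} (hr : r ∈ Ioo (0 : ℝ) 1) :
    hardyMean p f r ≤ ‖f‖ := le_ciSup f.2.2 ⟨r, hr⟩

lemma norm_le {f : HardySpace p} {C : ℝ} (h : ∀ r ∈ Ioo (0 : ℝ) 1, hardyMean p f r ≤ C) :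
    ‖f‖ ≤ C :=
  have : Nonempty (Ioo (0 : ℝ) 1) := ⟨⟨1 / 2, by norm_num, by norm_num⟩⟩
  ciSup_le fun r => h r r.2

/-- An analytic function on the disk with bounded integral means, as an element of `H^p`. -/
noncomputable def ofAnalytic (f : ℂ → ℂ) (hf : DifferentiableOn ℂ f (Metric.ball 0 1)) (C : ℝ)
    (hC : ∀ r ∈ Ioo (0 : ℝ) 1, hardyMean p f r ≤ C) : HardySpace p :=
  ⟨(Metric.ball (0 : ℂ) 1).indicator f, mem_diskAnalytic_indicator hf, C, by
    rintro _ ⟨r, rfl⟩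
    refine le_of_eq_of_le ?_ (hC r r.2)
    simp only [hardyMean]
    congr 1
    exact circleAverage_congr' r.2.1.le fun z hz => by
      rw [indicator_of_mem (sphere_subset_ball_zero_one r.2 hz)]⟩

lemma ofAnalytic_apply {f : ℂ → ℂ} (hf : DifferentiableOn ℂ f (Metric.ball 0 1)) {C : ℝ}
    (hC : ∀ r ∈ Ioo (0 : ℝ) 1, hardyMean p f r ≤ C) {z : ℂ} (hz : z ∈ Metric.ball (0 : ℂ) 1) :
    ofAnalytic f hf C hC z = f z := indicator_of_mem hz f

/-- The monomial `z ↦ z ^ n` as an element of `H^p`. -/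
noncomputable def monomial (p : ℝ) [hp : Fact (1 ≤ p)] (n : ℕ) : HardySpace p :=
  ofAnalytic (fun z => z ^ n) (by fun_prop) 1 fun r hr => by
    rw [hardyMean_le_iff pos_exponent _ _ zero_le_one, Real.one_rpow]
    refine Real.circleAverage_mono_on_of_le_circle ?_ fun z hz => ?_
    · exact ContinuousOn.circleIntegrable hr.1.le (ContinuousOn.rpow_const (by fun_prop)
        fun _ _ => Or.inr pos_exponent.le)
    · rw [abs_of_pos hr.1] at hz
      have : ‖z‖ ≤ 1 := by
        have := sphere_subset_ball_zero_one hr hz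
        simpa using (mem_ball_zero_iff.1 this).le
      rw [norm_pow]
      exact Real.rpow_le_one (by positivity) (pow_le_one₀ (norm_nonneg z) this) pos_exponent.le

lemma monomial_apply (n : ℕ) {z : ℂ} (hz : z ∈ Metric.ball (0 : ℂ) 1) :
    monomial p n z = z ^ n := ofAnalytic_apply _ _ hz

/-- Apply Cauchy's formula on |z| = r to f · (1 - conj a · z)^{2/p - 1} with a = w/r², so that the
evaluation point a r² is w. The integrand has modulus |f| |1 - conj a · z|^{-2(1 - 1/p)}, and Hölder
with exponents p and p' leaves the mean of the squared kernel, which is known exactly. Hence there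
is no loss in the constant. -/
lemma norm_apply_le_hardyMean (f : HardySpace p) {r : ℝ} (hr : r ∈ Ioo (0 : ℝ) 1) {w : ℂ}
    (hw : ‖w‖ < r) : ‖f w‖ ≤ hardyMean p f r * ((1 - ‖w‖ ^ 2 / r ^ 2) ^ (1 / p))⁻¹ := by
  have hr0 := hr.1
  have hp0 : 0 < p := pos_exponent
  set t : ℝ := 1 / p with ht
  have ht0 : 0 < t := by positivity
  have ht1 : t ≤ 1 := by rw [ht, div_le_one hp0]; exact hp.out
  set a : ℂ := w / r ^ 2 with ha
  have hna : ‖a‖ = ‖w‖ / r ^ 2 := by simp [ha]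
  have har : ‖a‖ * r < 1 := by
    rw [hna, div_mul_eq_mul_div, div_lt_one (by positivity)]; nlinarith
  have hS : ∀ z ∈ Metric.closedBall (0 : ℂ) r, ‖a‖ * ‖z‖ < 1 := fun z hz =>
    (mul_le_mul_of_nonneg_left (by simpa using hz) (norm_nonneg a)).trans_lt har
  have hS' : ∀ z ∈ Metric.sphere (0 : ℂ) r, ‖a‖ * ‖z‖ < 1 := fun z hz =>
    hS z (Metric.sphere_subset_closedBall hz)
  have hcb : Metric.closedBall (0 : ℂ) r ⊆ Metric.ball 0 1 :=
    Metric.closedBall_subset_ball hr.2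
  have hfd := f.2.1.1.mono hcb
  have hfc : ContinuousOn f.1 (Metric.sphere 0 r) :=
    hfd.continuousOn.mono Metric.sphere_subset_closedBall
  have hfp : ContinuousOn (fun z => ‖f z‖ ^ p) (Metric.sphere 0 r) :=
    hfc.norm.rpow_const fun _ _ => Or.inr hp0.le
  have hcauchy := circleAverage_div_one_sub_mul_conj hr0 (hfd.mul
    (differentiableOn_one_sub_conj_mul_cpow hS ((2 * t - 1 : ℝ) : ℂ))) har
  have haw : a * r ^ 2 = w := by
    rw [ha, div_mul_cancel₀]; exact_mod_cast (by positivity)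
  set D : ℝ := 1 - ‖w‖ ^ 2 / r ^ 2 with hD
  have hD0 : 0 < D := by
    rw [hD, sub_pos, div_lt_one (by positivity)]
    exact pow_lt_pow_left₀ hw (norm_nonneg w) two_ne_zero
  have hDw : 1 - (starRingEnd ℂ) a * w = (D : ℂ) := by
    have := Complex.conj_mul' w
    simp only [ha, hD, map_div₀, map_pow, Complex.conj_ofReal]
    push_cast
    rw [div_mul_eq_mul_div, this]
  have hDa : (1 - ‖a‖ ^ 2 * r ^ 2)⁻¹ = D⁻¹ := by
    rw [hna, hD]; congr 2; field_simp
  rw [haw, Pi.mul_apply, hDw] at hcauchy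
  have hker : ∀ z ∈ Metric.sphere (0 : ℂ) r, ‖(f.1 * fun z => (1 - (starRingEnd ℂ) a * z) ^
      ((2 * t - 1 : ℝ) : ℂ)) z / (1 - a * (starRingEnd ℂ) z)‖
      = (‖f z‖ ^ p) ^ t * (‖1 - (starRingEnd ℂ) a * z‖ ^ (-2 : ℝ)) ^ (1 - t) := fun z hz => by
    have h3 : ‖1 - a * (starRingEnd ℂ) z‖ = ‖1 - (starRingEnd ℂ) a * z‖ := by
      rw [← Complex.norm_conj]; simp
    have hpos := norm_one_sub_conj_mul_pos (hS' z hz)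
    rw [norm_div, h3, Pi.mul_apply, norm_mul, Complex.norm_cpow_real,
      ← Real.rpow_mul (norm_nonneg _), ← Real.rpow_mul (norm_nonneg _), ht,
      mul_one_div_cancel hp0.ne', Real.rpow_one, mul_div_assoc]
    congr 1
    nth_rewrite 2 [← Real.rpow_one ‖1 - (starRingEnd ℂ) a * z‖]
    rw [← Real.rpow_sub hpos]
    congr 1
    ring
  have hmain : ‖f w‖ * D ^ (2 * t - 1) ≤ hardyMean p f r * (D⁻¹) ^ (1 - t) := by
    have h1 := norm_circleAverage_le (fun z => (f.1 * fun z => (1 - (starRingEnd ℂ) a * z) ^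
      ((2 * t - 1 : ℝ) : ℂ)) z / (1 - a * (starRingEnd ℂ) z)) 0 r
    rw [hcauchy, circleAverage_congr' hr0.le hker, norm_mul, Complex.norm_cpow_real,
      Complex.norm_real, Real.norm_of_nonneg hD0.le] at h1
    refine h1.trans ?_
    -- For p = 1 the second Hölder weight 1 - t is zero and the two sides agree.
    rcases ht1.eq_or_lt with h | h
    · simp [h, hardyMean, ← ht]
    · have h2 := circleAverage_rpow_mul_rpow_le hr0.le hfp
        (continuousOn_norm_one_sub_conj_mul_rpow hS' (-2)) (fun z => by positivity)
        (fun z => by positivity) ht0 h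
      rwa [circleAverage_norm_one_sub_rpow_neg_two hr0 har, hDa] at h2
  have hDpos : 0 < D ^ (2 * t - 1) := Real.rpow_pos_of_pos hD0 _
  rw [← le_div_iff₀ hDpos] at hmain
  refine hmain.trans_eq ?_
  rw [mul_div_assoc, Real.inv_rpow hD0.le, ← Real.rpow_neg hD0.le, ← Real.rpow_neg hD0.le,
    ← Real.rpow_sub hD0]
  congr 2
  ring

/-- The growth estimate in `H^p`. -/
lemma norm_apply_le (f : HardySpace p) {w : ℂ} (hw : ‖w‖ < 1) :
    ‖f w‖ ≤ ‖f‖ * ((1 - ‖w‖ ^ 2) ^ (1 / p))⁻¹ := by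
  have hpos : 0 < 1 - ‖w‖ ^ 2 := by nlinarith [norm_nonneg w]
  have hlim : Tendsto (fun r : ℝ => ‖f‖ * ((1 - ‖w‖ ^ 2 / r ^ 2) ^ (1 / p))⁻¹) (𝓝[<] 1)
      (𝓝 (‖f‖ * ((1 - ‖w‖ ^ 2 / 1 ^ 2) ^ (1 / p))⁻¹)) := by
    have hc : ContinuousAt (fun r : ℝ => 1 - ‖w‖ ^ 2 / r ^ 2) 1 := by
      fun_prop (disch := norm_num)
    refine Tendsto.mono_left ?_ nhdsWithin_le_nhds
    refine Tendsto.const_mul _ (Tendsto.inv₀ (hc.tendsto.rpow_const (Or.inl ?_)) ?_)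
    · simpa using hpos.ne'
    · simpa using (Real.rpow_pos_of_pos hpos _).ne'
  rw [one_pow, div_one] at hlim
  refine ge_of_tendsto hlim ?_
  filter_upwards [Ioo_mem_nhdsLT hw] with r hr
  have hr0 : 0 < r := (norm_nonneg w).trans_lt hr.1
  refine (f.norm_apply_le_hardyMean ⟨hr0, hr.2⟩ hr.1).trans ?_
  refine mul_le_mul_of_nonneg_right (f.hardyMean_le_norm ⟨hr0, hr.2⟩) ?_
  refine inv_nonneg.2 (Real.rpow_nonneg (sub_nonneg.2 ?_) _)
  rw [div_le_one (by positivity)]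
  exact pow_le_pow_left₀ (norm_nonneg w) hr.1.le 2

end HardySpace

/-! ### Uniform approximation by Taylor polynomials and dilations. -/

namespace HardySpace

variable {p : ℝ} [hp : Fact (1 ≤ p)]

lemma norm_apply_le_of_norm_le (f : HardySpace p) {w : ℂ} {ρ : ℝ} (hw : ‖w‖ ≤ ρ) (hρ : ρ < 1) :
    ‖f w‖ ≤ ‖f‖ * ((1 - ρ ^ 2) ^ (1 / p))⁻¹ := by
  have h0 := norm_nonneg w
  have hp0 : 0 < p := pos_exponent
  have h1 : 0 < 1 - ρ ^ 2 := by nlinarith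
  refine (f.norm_apply_le (hw.trans_lt hρ)).trans ?_
  gcongr

lemma norm_iteratedDeriv_zero_le (f : HardySpace p) (n : ℕ) {ρ : ℝ} (hρ : ρ ∈ Ioo (0 : ℝ) 1) :
    ‖iteratedDeriv n f 0‖ ≤ n.factorial * (‖f‖ * ((1 - ρ ^ 2) ^ (1 / p))⁻¹) / ρ ^ n := by
  refine Complex.norm_iteratedDeriv_le_of_forall_mem_sphere_norm_le n hρ.1
    (f.2.1.1.diffContOnCl_ball (Metric.closedBall_subset_ball hρ.2)) fun z hz => ?_
  exact f.norm_apply_le_of_norm_le (by simpa using hz.le) hρ.2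

lemma contDiffAt_zero (f : HardySpace p) (n : WithTop ℕ∞) : ContDiffAt ℂ n f 0 :=
  (f.2.1.1.analyticAt (Metric.ball_mem_nhds 0 one_pos)).contDiffAt

/-- The `n`-th Taylor coefficient at the origin, as a bounded functional on `H^p`. -/
noncomputable def taylorCoeff (p : ℝ) [hp : Fact (1 ≤ p)] (n : ℕ) : HardySpace p →L[ℂ] ℂ :=
  LinearMap.mkContinuous
    { toFun := fun f => (n.factorial : ℂ)⁻¹ * iteratedDeriv n f 0
      map_add' := fun f g => by
        have : iteratedDeriv n (f + g : HardySpace p) 0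
            = iteratedDeriv n f 0 + iteratedDeriv n g 0 :=
          iteratedDeriv_add (f.contDiffAt_zero n) (g.contDiffAt_zero n)
        rw [this, mul_add]
      map_smul' := fun c f => by
        have : iteratedDeriv n (c • f : HardySpace p) 0 = c * iteratedDeriv n f 0 :=
          iteratedDeriv_const_smul (f.contDiffAt_zero n) c
        rw [this, RingHom.id_apply, smul_eq_mul]
        ring }
    (((1 - (1 / 2 : ℝ) ^ 2) ^ (1 / p))⁻¹ / (1 / 2) ^ n) fun f => by
      have h := f.norm_iteratedDeriv_zero_le n (ρ := 1 / 2) (by norm_num)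
      simp only [LinearMap.coe_mk, AddHom.coe_mk, norm_mul, norm_inv, Complex.norm_natCast]
      rw [inv_mul_le_iff₀ (by positivity)]
      refine h.trans_eq ?_
      ring

lemma taylorCoeff_apply (f : HardySpace p) (n : ℕ) :
    taylorCoeff p n f = (n.factorial : ℂ)⁻¹ * iteratedDeriv n f 0 := rfl

lemma norm_taylorCoeff_apply_le (f : HardySpace p) (n : ℕ) {ρ : ℝ} (hρ : ρ ∈ Ioo (0 : ℝ) 1) :
    ‖taylorCoeff p n f‖ ≤ ‖f‖ * ((1 - ρ ^ 2) ^ (1 / p))⁻¹ / ρ ^ n := by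
  rw [taylorCoeff_apply, norm_mul, norm_inv, Complex.norm_natCast,
    inv_mul_le_iff₀ (by positivity), ← mul_div_assoc]
  exact f.norm_iteratedDeriv_zero_le n hρ

lemma hasSum_taylorCoeff (f : HardySpace p) {w : ℂ} (hw : ‖w‖ < 1) :
    HasSum (fun n => taylorCoeff p n f * w ^ n) (f w) := by
  have h := Complex.hasSum_taylorSeries_on_ball (f := f.1) (c := 0) (r := 1) (z := w)
    f.2.1.1 (by simpa using hw)
  refine h.congr_fun fun n => ?_
  rw [taylorCoeff_apply, sub_zero, smul_eq_mul, smul_eq_mul]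
  ring

/-- Taylor polynomials converge uniformly on smaller disks and on bounded sets of `H^p`. -/
lemma exists_norm_apply_sub_taylor_le {r ε : ℝ} (hr : r ∈ Ioo (0 : ℝ) 1) (hε : 0 < ε) :
    ∃ N : ℕ, ∀ f : HardySpace p, ∀ w : ℂ, ‖w‖ ≤ r →
      ‖f w - ∑ n ∈ Finset.range N, taylorCoeff p n f * w ^ n‖ ≤ ε * ‖f‖ := by
  -- Cauchy estimates on the larger circle of radius ρ bound the n-th coefficient by ‖f‖ B ρ⁻ⁿ, so
  -- on |w| ≤ r the tail is geometric with ratio r/ρ, uniformly in f.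
  obtain ⟨ρ, hrρ, hρ1⟩ := exists_between hr.2
  have hρ0 : 0 < ρ := hr.1.trans hrρ
  set B := ((1 - ρ ^ 2) ^ (1 / p))⁻¹
  have hq : r / ρ < 1 := (div_lt_one hρ0).2 hrρ
  have hlim : Tendsto (fun N : ℕ => B * (r / ρ) ^ N / (1 - r / ρ)) atTop (𝓝 0) := by
    have := ((tendsto_pow_atTop_nhds_zero_of_lt_one (div_nonneg hr.1.le hρ0.le) hq).const_mul
      B).div_const (1 - r / ρ)
    simpa using this
  obtain ⟨N, hN⟩ := (hlim.eventually_le_const hε).exists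
  refine ⟨N, fun f w hw => ?_⟩
  have hterm : ∀ n, ‖taylorCoeff p n f * w ^ n‖ ≤ ‖f‖ * B * (r / ρ) ^ n := fun n => by
    rw [norm_mul, norm_pow, div_pow, mul_div_assoc', mul_div_right_comm]
    have hn := f.norm_taylorCoeff_apply_le n ⟨hρ0, hρ1⟩
    exact mul_le_mul hn (pow_le_pow_left₀ (norm_nonneg w) hw n) (by positivity)
      ((norm_nonneg _).trans hn)
  have h := norm_sub_le_of_geometric_bound_of_hasSum hq hterm
    (f.hasSum_taylorCoeff (hw.trans_lt hr.2)) N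
  rw [norm_sub_rev]
  refine h.trans ?_
  calc ‖f‖ * B * (r / ρ) ^ N / (1 - r / ρ) = ‖f‖ * (B * (r / ρ) ^ N / (1 - r / ρ)) := by ring
    _ ≤ ‖f‖ * ε := by gcongr
    _ = ε * ‖f‖ := mul_comm _ _

/-- Dilations converge to the identity uniformly on smaller disks and on bounded sets of `H^p`. -/
lemma exists_norm_apply_sub_dilation_le {s ε : ℝ} (hs0 : 0 ≤ s) (hs : s < 1) (hε : 0 < ε) :
    ∃ r ∈ Ioo (0 : ℝ) 1, ∀ f : HardySpace p, ∀ w : ℂ, ‖w‖ ≤ s →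
      ‖f w - f (r * w)‖ ≤ ε * ‖f‖ := by
  -- Half the gap to the unit circle: disks of radius R about points of |x| ≤ s stay in |z| ≤ s + R
  -- < 1. There the growth estimate and Cauchy's inequality give |f'| ≤ ‖f‖ B / R, and the mean
  -- value inequality finishes.
  set R := (1 - s) / 2 with hR
  have hR0 : 0 < R := by rw [hR]; linarith
  set B := ((1 - (s + R) ^ 2) ^ (1 / p))⁻¹
  have hlim : Tendsto (fun r : ℝ => B / R * (1 - r)) (𝓝[<] 1) (𝓝 0) := by
    have : Tendsto (fun r : ℝ => B / R * (1 - r)) (𝓝 1) (𝓝 (B / R * (1 - 1))) :=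
      Continuous.tendsto (by fun_prop) 1
    rw [sub_self, mul_zero] at this
    exact this.mono_left nhdsWithin_le_nhds
  obtain ⟨r, hrε, hr⟩ := ((hlim.eventually_le_const hε).and
    (Ioo_mem_nhdsLT (one_pos (α := ℝ)))).exists
  have hB : 0 ≤ B := inv_nonneg.2 (Real.rpow_nonneg (by nlinarith) _)
  refine ⟨r, hr, fun f w hw => ?_⟩
  have hin : ∀ x ∈ Metric.closedBall (0 : ℂ) s, ∀ z ∈ Metric.closedBall x R, ‖z‖ ≤ s + R :=
    fun x hx z hz => by
      rw [mem_closedBall_iff_norm] at hz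
      rw [mem_closedBall_zero_iff] at hx
      have := norm_add_le (z - x) x
      rw [sub_add_cancel] at this
      linarith
  have hd : ∀ x ∈ Metric.closedBall (0 : ℂ) s, ‖deriv f x‖ ≤ ‖f‖ * B / R := fun x hx => by
    refine Complex.norm_deriv_le_of_forall_mem_sphere_norm_le hR0
      (f.2.1.1.diffContOnCl_ball fun z hz => ?_) fun z hz => ?_
    · have := hin x hx z hz
      rw [mem_ball_zero_iff]
      linarith
    · exact f.norm_apply_le_of_norm_le (hin x hx z (Metric.sphere_subset_closedBall hz))
        (by linarith)
  have hrw : (r : ℂ) * w ∈ Metric.closedBall (0 : ℂ) s := by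
    rw [mem_closedBall_zero_iff, norm_mul, Complex.norm_real, Real.norm_of_nonneg hr.1.le]
    nlinarith [hr.2, norm_nonneg w, hr.1]
  have h := (convex_closedBall (0 : ℂ) s).norm_image_sub_le_of_norm_deriv_le
    (fun x hx => f.2.1.1.differentiableAt (Metric.isOpen_ball.mem_nhds
      (Metric.closedBall_subset_ball hs hx))) hd hrw (mem_closedBall_zero_iff.2 hw)
  have hsub : ‖w - r * w‖ ≤ 1 - r := by
    have : w - r * w = ((1 - r : ℝ) : ℂ) * w := by push_cast; ring
    rw [this, norm_mul, Complex.norm_real, Real.norm_of_nonneg (by linarith [hr.2])]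
    nlinarith [hr.2]
  calc ‖f w - f (r * w)‖ ≤ ‖f‖ * B / R * ‖w - r * w‖ := h
    _ ≤ ‖f‖ * B / R * (1 - r) := by gcongr
    _ = ‖f‖ * (B / R * (1 - r)) := by ring
    _ ≤ ‖f‖ * ε := by gcongr
    _ = ε * ‖f‖ := mul_comm _ _

/-- The finite rank operator `f ↦ ∑_{n < N} f̂(n) r ^ n T(z ^ n)`. -/
noncomputable def dilatedTaylor (T : HardySpace p →L[ℂ] HInfty) (r : ℝ) (N : ℕ) :
    HardySpace p →L[ℂ] HInfty :=
  ∑ n ∈ Finset.range N,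
    (ContinuousLinearMap.toSpanSingleton ℂ ((r : ℂ) ^ n • T (monomial p n))).comp (taylorCoeff p n)

lemma isCompactOperator_dilatedTaylor (T : HardySpace p →L[ℂ] HInfty) (r : ℝ) (N : ℕ) :
    IsCompactOperator (dilatedTaylor T r N) := by
  induction N with
  | zero => simpa [dilatedTaylor] using isCompactOperator_zero
  | succ N ih =>
    rw [dilatedTaylor, Finset.sum_range_succ]
    exact ih.add ((isCompactOperator_of_locallyCompactSpace_rng
      (ContinuousLinearMap.toSpanSingleton ℂ ((r : ℂ) ^ N • T (monomial p N)))).comp_clm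
      (taylorCoeff p N))

lemma dilatedTaylor_apply {T : HardySpace p →L[ℂ] HInfty} {u φ : ℂ → ℂ}
    (hφ : MapsTo φ (Metric.ball 0 1) (Metric.ball 0 1))
    (hT : ∀ f : HardySpace p, ∀ z ∈ Metric.ball (0 : ℂ) 1, T f z = u z * f (φ z)) (r : ℝ) (N : ℕ)
    (f : HardySpace p) {z : ℂ} (hz : z ∈ Metric.ball (0 : ℂ) 1) :
    dilatedTaylor T r N f z
      = u z * ∑ n ∈ Finset.range N, taylorCoeff p n f * (r * φ z) ^ n := by
  rw [dilatedTaylor, _root_.sum_apply, HInfty.sum_apply, Finset.mul_sum]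
  refine Finset.sum_congr rfl fun n _ => ?_
  rw [ContinuousLinearMap.comp_apply, ContinuousLinearMap.toSpanSingleton_apply,
    HInfty.smul_apply, HInfty.smul_apply, hT _ z hz, monomial_apply n (hφ hz), mul_pow]
  ring

end HardySpace

/-! ### The upper estimate. -/

lemma essentialNorm_le {X Y : Type*} [NormedAddCommGroup X] [NormedSpace ℂ X]
    [NormedAddCommGroup Y] [NormedSpace ℂ Y] (T : X →L[ℂ] Y) {K : X →L[ℂ] Y}
    (hK : IsCompactOperator K) : essentialNorm T ≤ ‖T - K‖ :=
  csInf_le ⟨0, by rintro _ ⟨K, _, rfl⟩; exact norm_nonneg _⟩ ⟨K, hK, rfl⟩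

lemma le_essentialNorm {X Y : Type*} [NormedAddCommGroup X] [NormedSpace ℂ X]
    [NormedAddCommGroup Y] [NormedSpace ℂ Y] {T : X →L[ℂ] Y} {c : ℝ}
    (h : ∀ K : X →L[ℂ] Y, IsCompactOperator K → c ≤ ‖T - K‖) : c ≤ essentialNorm T :=
  le_csInf ⟨_, 0, by simpa using isCompactOperator_zero, rfl⟩
    (by rintro _ ⟨K, hK, rfl⟩; exact h K hK)

section WeightedComposition

variable {p : ℝ} [hp : Fact (1 ≤ p)] {u φ : ℂ → ℂ} {T : HardySpace p →L[ℂ] HInfty}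

/-- The weight u is the image of the constant function 1, hence bounded. -/
lemma norm_weight_le
    (hT : ∀ f : HardySpace p, ∀ z ∈ Metric.ball (0 : ℂ) 1, T f z = u z * f (φ z))
    (hφ : MapsTo φ (Metric.ball 0 1) (Metric.ball 0 1)) {z : ℂ}
    (hz : z ∈ Metric.ball (0 : ℂ) 1) : ‖u z‖ ≤ ‖T (HardySpace.monomial p 0)‖ := by
  have := HInfty.norm_apply_le (T (HardySpace.monomial p 0)) z
  rwa [hT _ z hz, HardySpace.monomial_apply 0 (hφ hz), pow_zero, mul_one] at this

lemma essentialNorm_le_of_eventually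
    (hT : ∀ f : HardySpace p, ∀ z ∈ Metric.ball (0 : ℂ) 1, T f z = u z * f (φ z))
    (hφ : MapsTo φ (Metric.ball 0 1) (Metric.ball 0 1)) {c s : ℝ} (hs0 : 0 ≤ s) (hs : s < 1)
    (h : ∀ z ∈ Metric.ball (0 : ℂ) 1, s < ‖φ z‖ → ‖u z‖ / (1 - ‖φ z‖ ^ 2) ^ (1 / p) ≤ c)
    (hc : 0 ≤ c) : essentialNorm T ≤ 2 * c := by
  set U := ‖T (HardySpace.monomial p 0)‖ with hU
  have hU0 : 0 ≤ U := norm_nonneg _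
  refine le_of_forall_pos_le_add fun ε hε => ?_
  -- Two errors of size η, from dilation and from truncation, are each multiplied by |u| ≤ U; the
  -- extra 1 covers U = 0.
  set η := ε / (2 * (U + 1)) with hη
  have hη0 : 0 < η := by positivity
  have hUη : U * (2 * η) ≤ ε := by
    rw [hη]; field_simp; linarith
  obtain ⟨r, hr, hdil⟩ := HardySpace.exists_norm_apply_sub_dilation_le (p := p) hs0 hs hη0
  obtain ⟨N, hN⟩ := HardySpace.exists_norm_apply_sub_taylor_le (p := p) hr hη0
  refine (essentialNorm_le T (HardySpace.isCompactOperator_dilatedTaylor T r N)).trans ?_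
  refine ContinuousLinearMap.opNorm_le_bound _ (by positivity) fun f => HInfty.norm_le fun z hz => ?_
  have hw1 : ‖φ z‖ < 1 := by simpa using hφ hz
  have hu := norm_weight_le hT hφ hz
  rw [_root_.sub_apply, HInfty.sub_apply, hT f z hz,
    HardySpace.dilatedTaylor_apply hφ hT r N f hz, ← mul_sub, norm_mul]
  have hrw : ‖(r : ℂ) * φ z‖ ≤ r := by
    rw [norm_mul, Complex.norm_real, Real.norm_of_nonneg hr.1.le]
    exact mul_le_of_le_one_right hr.1.le hw1.le
  have hrw' : ‖(r : ℂ) * φ z‖ ≤ ‖φ z‖ := by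
    rw [norm_mul, Complex.norm_real, Real.norm_of_nonneg hr.1.le]
    exact mul_le_of_le_one_left (norm_nonneg _) hr.2.le
  have htail := hN f _ hrw
  set S := ∑ n ∈ Finset.range N, HardySpace.taylorCoeff p n f * (r * φ z) ^ n
  have htri : ‖f (φ z) - S‖ ≤ ‖f (φ z) - f (r * φ z)‖ + η * ‖f‖ := by
    have := norm_add_le (f (φ z) - f (r * φ z)) (f (r * φ z) - S)
    rw [sub_add_sub_cancel] at this
    linarith
  -- Inside |φ| ≤ s both approximations apply. Outside, the dilation error is not small and is
  -- bounded by two uses of the growth estimate, the second because |rφ(z)| ≤ |φ(z)|.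
  rcases le_or_gt ‖φ z‖ s with hws | hws
  · calc ‖u z‖ * ‖f (φ z) - S‖ ≤ U * (2 * η * ‖f‖) := by
          gcongr
          linarith [hdil f _ hws]
      _ = U * (2 * η) * ‖f‖ := by ring
      _ ≤ (2 * c + ε) * ‖f‖ := by gcongr; linarith
  · have hcz := h z hz hws
    have h1 := f.norm_apply_le_of_norm_le le_rfl hw1
    have h2 := f.norm_apply_le_of_norm_le hrw' hw1
    have h3 := norm_sub_le (f (φ z)) (f (r * φ z))
    set B := (1 - ‖φ z‖ ^ 2) ^ (1 / p)
    calc ‖u z‖ * ‖f (φ z) - S‖ ≤ ‖u z‖ * (2 * (‖f‖ * B⁻¹) + η * ‖f‖) := by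
          gcongr; linarith
      _ = (2 * (‖u z‖ / B) + ‖u z‖ * η) * ‖f‖ := by ring
      _ ≤ (2 * c + ε) * ‖f‖ := by
          have : ‖u z‖ * η ≤ U * (2 * η) := by gcongr; linarith
          gcongr
          linarith

/-- The upper estimate of the essential norm. -/
lemma essentialNorm_le_two_mul_weightLimsup
    (hT : ∀ f : HardySpace p, ∀ z ∈ Metric.ball (0 : ℂ) 1, T f z = u z * f (φ z))
    (hφ : MapsTo φ (Metric.ball 0 1) (Metric.ball 0 1)) :
    ENNReal.ofReal (essentialNorm T) ≤ 2 * weightLimsup p u φ := by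
  rw [mul_comm, ← ENNReal.div_le_iff (by norm_num) (by norm_num)]
  by_contra! hlt
  obtain ⟨c, hc1, hc2⟩ := exists_between hlt
  lift c to NNReal using hc2.ne_top
  have hev := eventually_lt_of_limsup_lt hc1
  rw [eventually_inf_principal, eventually_comap, Metric.eventually_nhds_iff] at hev
  obtain ⟨δ, hδ, hev⟩ := hev
  have hle : essentialNorm T ≤ 2 * (c : ℝ) := by
    -- The limsup condition holds for |φ(z)| within δ of 1; the maximum with 0 keeps the threshold
    -- nonnegative when δ > 1.
    refine essentialNorm_le_of_eventually hT hφ (s := max 0 (1 - δ)) (le_max_left _ _)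
      (max_lt one_pos (by linarith)) (fun z hz hsz => ?_) c.2
    have hz1 : ‖φ z‖ < 1 := by simpa using hφ hz
    have hd : dist ‖φ z‖ 1 < δ := by
      rw [Real.dist_eq, abs_sub_comm, abs_of_pos (by linarith)]
      linarith [le_max_right 0 (1 - δ)]
    have := hev hd z rfl hz
    rw [← ENNReal.ofReal_coe_nnreal] at this
    exact ((ENNReal.ofReal_lt_ofReal_iff_of_nonneg (by
      have : 0 ≤ 1 - ‖φ z‖ ^ 2 := by nlinarith [norm_nonneg (φ z)]
      positivity)).1 this).le
  refine hc2.not_ge (ENNReal.div_le_of_le_mul ?_)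
  rw [mul_comm, ← ENNReal.ofReal_coe_nnreal, ← ENNReal.ofReal_ofNat 2,
    ← ENNReal.ofReal_mul zero_le_two]
  exact ENNReal.ofReal_le_ofReal hle

end WeightedComposition

/-! ### Squared Cauchy kernels and their correlations. -/

/-- Subadditivity of x^q when q ≤ 1 and the power mean inequality when q ≥ 1; the exponent of N,
namely max(q - 1, 0), covers both. -/
lemma rpow_sum_le_card_rpow_mul_sum_rpow {q : ℝ} (hq : 0 < q) (N : ℕ) {x : ℕ → ℝ}
    (hx : ∀ i, 0 ≤ x i) :
    (∑ i ∈ Finset.range N, x i) ^ q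
      ≤ (N : ℝ) ^ (q - min q 1) * ∑ i ∈ Finset.range N, x i ^ q := by
  rcases le_total q 1 with h | h
  · rw [min_eq_left h, sub_self, Real.rpow_zero, one_mul]
    induction N with
    | zero => simp [Real.zero_rpow hq.ne']
    | succ N ih =>
      rw [Finset.sum_range_succ, Finset.sum_range_succ]
      exact (Real.rpow_add_le_add_rpow (Finset.sum_nonneg fun i _ => hx i) (hx N) hq.le h).trans
        (by gcongr)
  · rw [min_eq_right h]
    simpa using Real.rpow_sum_le_const_mul_sum_rpow_of_nonneg (s := Finset.range N) h
      (fun i _ => hx i)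

/-- The squared Cauchy kernel at `w`, normalised to have integral means at most `1`. -/
noncomputable def sqKernel (w z : ℂ) : ℝ :=
  (1 - ‖w‖ ^ 2) * ‖1 - (starRingEnd ℂ) w * z‖ ^ (-2 : ℝ)

section sqKernel

variable {w z : ℂ} {r : ℝ}

lemma one_sub_norm_sq_pos (hw : ‖w‖ < 1) : 0 < 1 - ‖w‖ ^ 2 := by nlinarith [norm_nonneg w]

lemma norm_mul_norm_lt_one (hw : ‖w‖ < 1) (hz : ‖z‖ < 1) : ‖w‖ * ‖z‖ < 1 :=
  mul_lt_one_of_nonneg_of_lt_one_left (norm_nonneg w) hw hz.le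

lemma norm_mul_norm_lt_one_of_mem_sphere (hw : ‖w‖ < 1) (hr : r ∈ Ioo (0 : ℝ) 1) :
    ∀ z ∈ Metric.sphere (0 : ℂ) r, ‖w‖ * ‖z‖ < 1 := fun _ hz =>
  norm_mul_norm_lt_one hw (mem_ball_zero_iff.1 (sphere_subset_ball_zero_one hr hz))

lemma sqKernel_nonneg (hw : ‖w‖ < 1) (z : ℂ) : 0 ≤ sqKernel w z :=
  mul_nonneg (one_sub_norm_sq_pos hw).le (by positivity)

lemma continuousOn_sqKernel (hw : ‖w‖ < 1) (hr : r ∈ Ioo (0 : ℝ) 1) :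
    ContinuousOn (sqKernel w) (Metric.sphere 0 r) :=
  (continuousOn_norm_one_sub_conj_mul_rpow (norm_mul_norm_lt_one_of_mem_sphere hw hr) _).const_mul _

lemma continuousOn_sqKernel_rpow (hw : ‖w‖ < 1) (hr : r ∈ Ioo (0 : ℝ) 1) {b : ℝ} (hb : 0 ≤ b) :
    ContinuousOn (fun z => sqKernel w z ^ b) (Metric.sphere 0 r) :=
  (continuousOn_sqKernel hw hr).rpow_const fun _ _ => Or.inr hb

lemma circleAverage_sqKernel_le_one (hw : ‖w‖ < 1) (hr : r ∈ Ioo (0 : ℝ) 1) :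
    Real.circleAverage (sqKernel w) 0 r ≤ 1 := by
  have hwr : ‖w‖ * r < 1 := by nlinarith [hr.1, hr.2, norm_nonneg w]
  have : Real.circleAverage (sqKernel w) 0 r = (1 - ‖w‖ ^ 2) * (1 - ‖w‖ ^ 2 * r ^ 2)⁻¹ := by
    rw [← circleAverage_norm_one_sub_rpow_neg_two hr.1 hwr, ← circleAverage_const_mul]
    rfl
  have hr2 : r ^ 2 ≤ 1 := pow_le_one₀ hr.1.le hr.2.le
  have hle : 1 - ‖w‖ ^ 2 ≤ 1 - ‖w‖ ^ 2 * r ^ 2 := by nlinarith [sq_nonneg ‖w‖]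
  have := one_sub_norm_sq_pos hw
  rw [‹Real.circleAverage _ _ _ = _›, ← div_eq_mul_inv, div_le_one (by linarith)]
  exact hle

lemma one_sub_norm_le_norm_one_sub (hz : ‖z‖ ≤ 1) : 1 - ‖w‖ ≤ ‖1 - (starRingEnd ℂ) w * z‖ := by
  have h1 := norm_sub_norm_le 1 ((starRingEnd ℂ) w * z)
  rw [norm_one, norm_mul, Complex.norm_conj] at h1
  nlinarith [norm_nonneg w]

lemma sqKernel_le (hw : ‖w‖ < 1) (hz : ‖z‖ ≤ 1) : sqKernel w z ≤ (1 - ‖w‖) ^ (-2 : ℝ) := by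
  have h1 := one_sub_norm_le_norm_one_sub (w := w) hz
  have h2 : ‖1 - (starRingEnd ℂ) w * z‖ ^ (-2 : ℝ) ≤ (1 - ‖w‖) ^ (-2 : ℝ) :=
    Real.rpow_le_rpow_of_nonpos (by linarith) h1 (by norm_num)
  have h3 := one_sub_norm_sq_pos hw
  calc sqKernel w z ≤ 1 * (1 - ‖w‖) ^ (-2 : ℝ) :=
        mul_le_mul (by nlinarith [sq_nonneg ‖w‖]) h2 (by positivity) zero_le_one
    _ = _ := one_mul _

/-- Interpolation between the exponents b/2 and 1. At b/2 the power of |1 - conj w · z| is -b > -1,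
so the cosine bound applies and the factor (1 - |w|²)^{b/2} survives; at 1 the mean is at most 1.
The bound does not depend on r and tends to 0 as |w| → 1. -/
lemma circleAverage_sqKernel_rpow_le (hw : ‖w‖ < 1) (hr : r ∈ Ioo (0 : ℝ) 1) {b : ℝ} (hb : 0 < b)
    (hb1 : b < 1) : Real.circleAverage (fun z => sqKernel w z ^ b) 0 r
      ≤ ((1 - ‖w‖ ^ 2) ^ (b / 2) * (Real.cos (b * (Real.pi / 2)))⁻¹) ^ ((1 - b) / (1 - b / 2)) := by
  have hwr : ‖w‖ * r < 1 := by nlinarith [hr.1, hr.2, norm_nonneg w]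
  set t := (1 - b) / (1 - b / 2) with ht
  have hb2 : 0 < 1 - b / 2 := by linarith
  have ht0 : 0 < t := div_pos (by linarith) hb2
  have ht1 : t < 1 := by rw [ht, div_lt_one hb2]; linarith
  have hbt : b / 2 * t + (1 - t) = b := by
    have : t * (1 - b / 2) = 1 - b := div_mul_cancel₀ _ hb2.ne'
    linear_combination -this
  have h1 := circleAverage_rpow_mul_rpow_le hr.1.le
    (continuousOn_sqKernel_rpow hw hr (half_pos hb).le) (continuousOn_sqKernel hw hr)
    (fun z => Real.rpow_nonneg (sqKernel_nonneg hw z) _) (sqKernel_nonneg hw) ht0 ht1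
  have h2 : (fun z => (sqKernel w z ^ (b / 2)) ^ t * sqKernel w z ^ (1 - t))
      = fun z => sqKernel w z ^ b := by
    funext z
    have h0 := sqKernel_nonneg hw z
    rw [← Real.rpow_mul h0, ← Real.rpow_add_of_nonneg h0 (by positivity) (by linarith), hbt]
  have h3 : (fun z => sqKernel w z ^ (b / 2))
      = fun z => (1 - ‖w‖ ^ 2) ^ (b / 2) * ‖1 - (starRingEnd ℂ) w * z‖ ^ (-b) := by
    funext z
    rw [sqKernel, Real.mul_rpow (one_sub_norm_sq_pos hw).le (by positivity),
      ← Real.rpow_mul (norm_nonneg _)]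
    congr 2
    ring
  have hδ := one_sub_norm_sq_pos hw
  have hA0 : 0 ≤ Real.circleAverage (fun z => sqKernel w z ^ (b / 2)) 0 r :=
    Real.circleAverage_nonneg_of_nonneg fun z _ => Real.rpow_nonneg (sqKernel_nonneg hw z) _
  have hB0 : 0 ≤ Real.circleAverage (sqKernel w) 0 r :=
    Real.circleAverage_nonneg_of_nonneg fun z _ => sqKernel_nonneg hw z
  rw [h2] at h1
  refine h1.trans ?_
  rw [← mul_one ((_ * _ : ℝ) ^ t)]
  refine mul_le_mul (Real.rpow_le_rpow hA0 ?_ ht0.le) (Real.rpow_le_one hB0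
    (circleAverage_sqKernel_le_one hw hr) (by linarith)) (by positivity) ?_
  · rw [h3, circleAverage_const_mul]
    gcongr
    exact circleAverage_norm_one_sub_rpow_neg_le hr.1 hwr hb hb1
  · refine Real.rpow_nonneg (mul_nonneg (by positivity) (inv_nonneg.2 ?_)) _
    exact Real.cos_nonneg_of_mem_Icc
      ⟨by nlinarith [Real.pi_pos], by nlinarith [Real.pi_pos]⟩

lemma eventually_circleAverage_sqKernel_rpow_le {w : ℕ → ℂ} (hw : ∀ n, ‖w n‖ < 1)
    (hlim : Tendsto (fun n => ‖w n‖) atTop (𝓝 1)) {b η : ℝ} (hb : 0 < b) (hb1 : b < 1)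
    (hη : 0 < η) : ∀ᶠ n in atTop, ∀ r ∈ Ioo (0 : ℝ) 1,
      Real.circleAverage (fun z => sqKernel (w n) z ^ b) 0 r ≤ η := by
  have hexp : 0 < (1 - b) / (1 - b / 2) := div_pos (by linarith) (by linarith)
  have h1 : Tendsto (fun n => ((1 - ‖w n‖ ^ 2) ^ (b / 2) * (Real.cos (b * (Real.pi / 2)))⁻¹) ^
      ((1 - b) / (1 - b / 2))) atTop (𝓝 0) := by
    have h2 : Tendsto (fun n => 1 - ‖w n‖ ^ 2) atTop (𝓝 0) := by
      simpa using (hlim.pow 2).const_sub 1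
    have h3 := h2.rpow_const (p := b / 2) (Or.inr (half_pos hb).le)
    rw [Real.zero_rpow (half_pos hb).ne'] at h3
    have h4 := (h3.mul_const (Real.cos (b * (Real.pi / 2)))⁻¹).rpow_const
      (p := (1 - b) / (1 - b / 2)) (Or.inr hexp.le)
    rwa [zero_mul, Real.zero_rpow hexp.ne'] at h4
  filter_upwards [h1.eventually_le_const hη] with n hn r hr
  exact (circleAverage_sqKernel_rpow_le (hw n) hr hb hb1).trans hn

/-- The kernel at the fixed point a is bounded on the disk, while the fractional power of the moving
kernel has vanishing mean. Uniformity in r is needed because the H^p norm is a supremum over r. -/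
lemma eventually_circleAverage_sqKernel_mul_le {w : ℕ → ℂ} (hw : ∀ n, ‖w n‖ < 1)
    (hlim : Tendsto (fun n => ‖w n‖) atTop (𝓝 1)) {a : ℂ} (ha : ‖a‖ < 1) {t η : ℝ} (ht : 0 < t)
    (ht1 : t < 1) (hη : 0 < η) : ∀ᶠ n in atTop, ∀ r ∈ Ioo (0 : ℝ) 1,
      Real.circleAverage (fun z => sqKernel a z ^ t * sqKernel (w n) z ^ (1 - t)) 0 r ≤ η := by
  set B := ((1 - ‖a‖) ^ (-2 : ℝ)) ^ t with hB
  have hB0 : 0 < B := Real.rpow_pos_of_pos (Real.rpow_pos_of_pos (by linarith) _) _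
  filter_upwards [eventually_circleAverage_sqKernel_rpow_le hw hlim (b := 1 - t) (by linarith)
    (by linarith) (div_pos hη hB0)] with n hn r hr
  have h1 := hn r hr
  rw [le_div_iff₀ hB0, mul_comm, ← circleAverage_const_mul] at h1
  refine le_trans (circleAverage_mono' hr.1.le ?_ ?_ fun z hz => ?_) h1
  · exact (continuousOn_sqKernel_rpow ha hr ht.le).mul
      (continuousOn_sqKernel_rpow (hw n) hr (by linarith))
  · exact (continuousOn_sqKernel_rpow (hw n) hr (by linarith)).const_mul _
  · have hz1 := mem_ball_zero_iff.1 (sphere_subset_ball_zero_one hr hz)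
    refine mul_le_mul_of_nonneg_right ?_ (Real.rpow_nonneg (sqKernel_nonneg (hw n) z) _)
    exact Real.rpow_le_rpow (sqKernel_nonneg ha z) (sqKernel_le ha hz1.le) ht.le

end sqKernel

/-! ### Normalised kernels in H^p and the smallness of their averages. -/

namespace HardySpace

variable {p : ℝ}

/-- The function `z ↦ ((1 - |w|²) / (1 - conj w * z)²) ^ (1 / p)`. -/
noncomputable def kernelFun (p : ℝ) (w z : ℂ) : ℂ :=
  ((1 - ‖w‖ ^ 2) ^ (1 / p) : ℝ) * (1 - (starRingEnd ℂ) w * z) ^ ((-2 / p : ℝ) : ℂ)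

lemma norm_kernelFun {w : ℂ} (hw : ‖w‖ < 1) (z : ℂ) :
    ‖kernelFun p w z‖ = sqKernel w z ^ (1 / p) := by
  have h := one_sub_norm_sq_pos hw
  rw [kernelFun, norm_mul, Complex.norm_real, Complex.norm_cpow_real,
    Real.norm_of_nonneg (by positivity), sqKernel, Real.mul_rpow h.le (by positivity),
    ← Real.rpow_mul (norm_nonneg _)]
  congr 2
  ring

lemma differentiableOn_kernelFun {w : ℂ} (hw : ‖w‖ < 1) :
    DifferentiableOn ℂ (kernelFun p w) (Metric.ball 0 1) :=
  (differentiableOn_one_sub_conj_mul_cpow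
    (fun _ hz => norm_mul_norm_lt_one hw (mem_ball_zero_iff.1 hz)) _).const_mul _

variable [hp : Fact (1 ≤ p)]

lemma hardyMean_kernelFun_le_one {w : ℂ} (hw : ‖w‖ < 1) {r : ℝ} (hr : r ∈ Ioo (0 : ℝ) 1) :
    hardyMean p (kernelFun p w) r ≤ 1 := by
  have hp0 : 0 < p := pos_exponent
  rw [hardyMean_le_iff hp0 _ _ zero_le_one, Real.one_rpow]
  refine le_of_eq_of_le ?_ (circleAverage_sqKernel_le_one hw hr)
  congr 1
  funext z
  rw [norm_kernelFun hw, ← Real.rpow_mul (sqKernel_nonneg hw z), one_div_mul_cancel hp0.ne',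
    Real.rpow_one]

/-- The normalised kernel function of `H^p` at the point `w` of the disk. -/
noncomputable def kernel (p : ℝ) [hp : Fact (1 ≤ p)] (w : Metric.ball (0 : ℂ) 1) : HardySpace p :=
  ofAnalytic (kernelFun p w) (differentiableOn_kernelFun (mem_ball_zero_iff.1 w.2)) 1
    fun _ hr => hardyMean_kernelFun_le_one (mem_ball_zero_iff.1 w.2) hr

lemma norm_kernel_apply (w : Metric.ball (0 : ℂ) 1) {z : ℂ} (hz : z ∈ Metric.ball (0 : ℂ) 1) :
    ‖kernel p w z‖ = sqKernel w z ^ (1 / p) := by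
  rw [kernel, ofAnalytic_apply _ _ hz, norm_kernelFun (mem_ball_zero_iff.1 w.2)]

lemma norm_kernel_apply_self (w : Metric.ball (0 : ℂ) 1) :
    ‖kernel p w w‖ = ((1 - ‖(w : ℂ)‖ ^ 2) ^ (1 / p))⁻¹ := by
  have h := one_sub_norm_sq_pos (mem_ball_zero_iff.1 w.2)
  have h1 : 1 - (starRingEnd ℂ) (w : ℂ) * w = ((1 - ‖(w : ℂ)‖ ^ 2 : ℝ) : ℂ) := by
    rw [Complex.conj_mul']; push_cast; ring
  rw [norm_kernel_apply w w.2, sqKernel, h1, Complex.norm_real, Real.norm_of_nonneg h.le,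
    ← Real.inv_rpow h.le]
  congr 1
  rw [← Real.rpow_neg_one (1 - _)]
  nth_rewrite 1 [← Real.rpow_one (1 - _)]
  rw [← Real.rpow_add h]
  norm_num

lemma norm_kernel_le_one (w : Metric.ball (0 : ℂ) 1) : ‖kernel p w‖ ≤ 1 := by
  refine norm_le fun r hr => ?_
  have hp0 : 0 < p := pos_exponent
  rw [hardyMean_le_iff hp0 _ _ zero_le_one, Real.one_rpow]
  refine le_of_eq_of_le (circleAverage_congr' hr.1.le fun z hz => ?_)
    (circleAverage_sqKernel_le_one (mem_ball_zero_iff.1 w.2) hr)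
  rw [norm_kernel_apply w (sphere_subset_ball_zero_one hr hz),
    ← Real.rpow_mul (sqKernel_nonneg (mem_ball_zero_iff.1 w.2) z), one_div_mul_cancel hp0.ne',
    Real.rpow_one]

/-- Sums of kernel functions with small mutual correlations have small norm. -/
lemma norm_sum_kernel_le (hp1 : 1 < p) {N : ℕ} (hN : 0 < N) (w : ℕ → Metric.ball (0 : ℂ) 1)
    (hcor : ∀ i j, i ≠ j → ∀ r ∈ Ioo (0 : ℝ) 1, Real.circleAverage
      (fun z => sqKernel (w i) z ^ (1 / p) * sqKernel (w j) z ^ (1 - 1 / p)) 0 r ≤ 1 / N) :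
    ‖∑ i ∈ Finset.range N, kernel p (w i)‖
      ≤ (2 * (N : ℝ) ^ (-min (p - 1) 1)) ^ (1 / p) * N := by
  have hp0 : 0 < p := pos_exponent
  have hN0 : (0 : ℝ) < N := by exact_mod_cast hN
  have hw : ∀ i, ‖(w i : ℂ)‖ < 1 := fun i => mem_ball_zero_iff.1 (w i).2
  have ht0 : 0 < 1 / p := by positivity
  have ht1 : 0 < 1 - 1 / p := by rw [sub_pos, div_lt_one hp0]; exact hp1
  set κ := min (p - 1) 1 with hκ
  have hC : 0 ≤ (2 * (N : ℝ) ^ (-κ)) ^ (1 / p) * N := by positivity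
  refine norm_le fun r hr => ?_
  rw [hardyMean_le_iff hp0 _ _ hC, Real.mul_rpow (by positivity) hN0.le,
    ← Real.rpow_mul (by positivity), one_div_mul_cancel hp0.ne', Real.rpow_one]
  set A : ℕ → ℕ → ℂ → ℝ := fun i j z =>
    sqKernel (w i) z ^ (1 / p) * sqKernel (w j) z ^ (1 - 1 / p)
  have hAc : ∀ i j, ContinuousOn (A i j) (Metric.sphere 0 r) := fun i j =>
    (continuousOn_sqKernel_rpow (hw i) hr ht0.le).mul (continuousOn_sqKernel_rpow (hw j) hr ht1.le)
  -- With S the sum of the moduli, write S^p = S · S^{p-1} and expand the second factor termwise: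
  -- the product becomes a double sum of correlations, at the cost of N^{p-1-κ}.
  have hpt : ∀ z ∈ Metric.sphere (0 : ℂ) r, ‖(∑ i ∈ Finset.range N, kernel p (w i)) z‖ ^ p
      ≤ (N : ℝ) ^ (p - 1 - κ) * ∑ i ∈ Finset.range N, ∑ j ∈ Finset.range N, A i j z := fun z hz => by
    have hz1 := sphere_subset_ball_zero_one hr hz
    have hx : ∀ i, 0 ≤ sqKernel (w i) z ^ (1 / p) := fun i =>
      Real.rpow_nonneg (sqKernel_nonneg (hw i) z) _
    have h1 : ‖(∑ i ∈ Finset.range N, kernel p (w i)) z‖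
        ≤ ∑ i ∈ Finset.range N, sqKernel (w i) z ^ (1 / p) := by
      rw [sum_apply]
      refine (norm_sum_le _ _).trans_eq (Finset.sum_congr rfl fun i _ => norm_kernel_apply _ hz1)
    have hS : 0 ≤ ∑ i ∈ Finset.range N, sqKernel (w i) z ^ (1 / p) :=
      Finset.sum_nonneg fun i _ => hx i
    have h2 := rpow_sum_le_card_rpow_mul_sum_rpow (sub_pos.2 hp1) N hx
    have h3 : ∀ j, (sqKernel (w j) z ^ (1 / p)) ^ (p - 1) = sqKernel (w j) z ^ (1 - 1 / p) :=
      fun j => by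
        rw [← Real.rpow_mul (sqKernel_nonneg (hw j) z)]
        congr 1
        field_simp
    simp only [h3] at h2
    calc _ ≤ (∑ i ∈ Finset.range N, sqKernel (w i) z ^ (1 / p)) ^ p := by gcongr
      _ = (∑ i ∈ Finset.range N, sqKernel (w i) z ^ (1 / p)) *
          (∑ i ∈ Finset.range N, sqKernel (w i) z ^ (1 / p)) ^ (p - 1) := by
        rw [← Real.rpow_one_add' hS (by linarith), add_sub_cancel]
      _ ≤ (∑ i ∈ Finset.range N, sqKernel (w i) z ^ (1 / p)) * ((N : ℝ) ^ (p - 1 - κ) *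
          ∑ j ∈ Finset.range N, sqKernel (w j) z ^ (1 - 1 / p)) := by gcongr
      _ = _ := by
        rw [mul_left_comm, Finset.sum_mul_sum]
  have hAavg : ∀ i j, Real.circleAverage (A i j) 0 r ≤ (if i = j then 1 else 0) + 1 / N :=
    fun i j => by
      split_ifs with hij
      · subst hij
        have : A i i = sqKernel (w i) := by
          funext z
          have h0 := sqKernel_nonneg (hw i) z
          simp only [A]
          rw [← Real.rpow_add_of_nonneg h0 ht0.le ht1.le, add_sub_cancel, Real.rpow_one]
        rw [this]
        have := circleAverage_sqKernel_le_one (hw i) hr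
        have : (0 : ℝ) ≤ 1 / N := by positivity
        linarith
      · rw [zero_add]; exact hcor i j hij r hr
  have hfc : ContinuousOn (fun z => ‖(∑ i ∈ Finset.range N, kernel p (w i)) z‖ ^ p)
      (Metric.sphere 0 r) :=
    ((∑ i ∈ Finset.range N, kernel p (w i)).2.1.1.continuousOn.mono
      (sphere_subset_ball_zero_one hr)).norm.rpow_const fun _ _ => Or.inr hp0.le
  have hAs : ∀ i, ContinuousOn (fun z => ∑ j ∈ Finset.range N, A i j z) (Metric.sphere 0 r) :=
    fun i => continuousOn_finsetSum _ fun j _ => hAc i j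
  refine (circleAverage_mono' hr.1.le hfc
    ((continuousOn_finsetSum _ fun i _ => hAs i).const_mul _) hpt).trans ?_
  rw [circleAverage_const_mul,
    Real.circleAverage_fun_sum fun i _ => (hAs i).circleIntegrable hr.1.le]
  simp only [Real.circleAverage_fun_sum fun j _ => (hAc _ j).circleIntegrable hr.1.le]
  -- Each row of the correlation matrix sums to at most 1 + N · (1/N) = 2. The total 2 N^{p-κ} beats
  -- N^p because κ > 0, which is where p > 1 matters.
  calc (N : ℝ) ^ (p - 1 - κ) *
        ∑ i ∈ Finset.range N, ∑ j ∈ Finset.range N, Real.circleAverage (A i j) 0 r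
      ≤ (N : ℝ) ^ (p - 1 - κ) * ∑ i ∈ Finset.range N, ∑ j ∈ Finset.range N,
        ((if i = j then 1 else 0) + 1 / (N : ℝ)) := by
        gcongr with i _ j _
        exact hAavg i j
    _ = (N : ℝ) ^ (p - 1 - κ) * (2 * N) := by
        congr 1
        have : ∀ i ∈ Finset.range N, ∑ j ∈ Finset.range N,
            ((if i = j then 1 else 0) + 1 / (N : ℝ)) = 2 := fun i hi => by
          rw [Finset.sum_add_distrib, Finset.sum_ite_eq, if_pos hi, Finset.sum_const,
            Finset.card_range, nsmul_eq_mul, mul_one_div_cancel hN0.ne']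
          norm_num
        rw [Finset.sum_congr rfl this, Finset.sum_const, Finset.card_range, nsmul_eq_mul, mul_comm]
    _ = 2 * (N : ℝ) ^ (-κ) * (N : ℝ) ^ p := by
        rw [mul_left_comm, mul_assoc, ← Real.rpow_add hN0]
        nth_rewrite 2 [← Real.rpow_one (N : ℝ)]
        rw [← Real.rpow_add hN0]
        congr 2
        ring

end HardySpace

namespace HardySpace

variable {p : ℝ} [hp : Fact (1 ≤ p)]

/-- For `p > 1`, suitable averages of normalised kernel functions at points tending to the unit
circle are small in `H^p`. -/
lemma exists_norm_sum_kernel_le (hp1 : 1 < p) {w : ℕ → Metric.ball (0 : ℂ) 1}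
    (hlim : Tendsto (fun n => ‖(w n : ℂ)‖) atTop (𝓝 1)) {P : ℕ → Prop} (hP : ∀ᶠ n in atTop, P n)
    {ε : ℝ} (hε : 0 < ε) : ∃ N : ℕ, 0 < N ∧ ∃ g : ℕ → ℕ, (∀ i, P (g i)) ∧
      ‖∑ i ∈ Finset.range N, kernel p (w (g i))‖ ≤ ε * N := by
  have hp0 : 0 < p := pos_exponent
  have hw : ∀ i, ‖(w i : ℂ)‖ < 1 := fun i => mem_ball_zero_iff.1 (w i).2
  have ht0 : 0 < 1 / p := by positivity
  have ht1 : 1 / p < 1 := by rw [div_lt_one hp0]; exact hp1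
  have hκ : 0 < min (p - 1) 1 := lt_min (sub_pos.2 hp1) one_pos
  have hN : Tendsto (fun N : ℕ => (2 * (N : ℝ) ^ (-min (p - 1) 1)) ^ (1 / p)) atTop (𝓝 0) := by
    have h1 := (((tendsto_rpow_neg_atTop hκ).comp tendsto_natCast_atTop_atTop).const_mul
      (2 : ℝ)).rpow_const (p := 1 / p) (Or.inr ht0.le)
    rwa [mul_zero, Real.zero_rpow ht0.ne'] at h1
  obtain ⟨N, hNε, hN0⟩ := ((hN.eventually_le_const hε).and (eventually_gt_atTop 0)).exists
  have hN0' : (0 : ℝ) < N := by exact_mod_cast hN0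
  -- The extracted sequence satisfies R only for i < j, so both orders of the asymmetric correlation
  -- are built into R.
  set R : ℕ → ℕ → Prop := fun i j => ∀ r ∈ Ioo (0 : ℝ) 1,
    Real.circleAverage (fun z => sqKernel (w i) z ^ (1 / p) * sqKernel (w j) z ^ (1 - 1 / p)) 0 r
      ≤ 1 / N ∧
    Real.circleAverage (fun z => sqKernel (w j) z ^ (1 / p) * sqKernel (w i) z ^ (1 - 1 / p)) 0 r
      ≤ 1 / N
  have hR : ∀ i, ∀ᶠ j in atTop, R i j := fun i => by
    filter_upwards [eventually_circleAverage_sqKernel_mul_le hw hlim (hw i) ht0 ht1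
      (one_div_pos.2 hN0'), eventually_circleAverage_sqKernel_mul_le hw hlim (hw i)
      (t := 1 - 1 / p) (by linarith) (by linarith) (one_div_pos.2 hN0')] with j h1 h2 r hr
    refine ⟨h1 r hr, ?_⟩
    have := h2 r hr
    simp only [sub_sub_cancel] at this
    simpa only [mul_comm] using this
  obtain ⟨g, hgP, hgR⟩ := exists_seq_of_forall_finset_exists P R fun s _ =>
    (hP.and ((Finset.eventually_all s).2 fun i _ => hR i)).exists
  refine ⟨N, hN0, g, hgP, ?_⟩
  refine (norm_sum_kernel_le hp1 hN0 (fun i => w (g i)) fun i j hij r hr => ?_).trans (by gcongr)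
  rcases lt_or_gt_of_ne hij with h | h
  · exact (hgR i j h r hr).1
  · exact (hgR j i h r hr).2

/-- An average of kernels far along the sequence is mapped within η of y, yet its own norm is at
most η; hence ‖y‖ ≤ (1 + ‖K‖) η. -/
lemma eq_zero_of_tendsto_apply_kernel {Y : Type*} [NormedAddCommGroup Y] [NormedSpace ℂ Y]
    (hp1 : 1 < p) {w : ℕ → Metric.ball (0 : ℂ) 1}
    (hlim : Tendsto (fun n => ‖(w n : ℂ)‖) atTop (𝓝 1)) (K : HardySpace p →L[ℂ] Y) {y : Y}
    (hK : Tendsto (fun n => K (kernel p (w n))) atTop (𝓝 y)) : y = 0 := by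
  rw [← norm_le_zero_iff]
  refine le_of_forall_pos_le_add fun ε hε => ?_
  set η := ε / (1 + ‖K‖) with hη
  have hη0 : 0 < η := by positivity
  have hP : ∀ᶠ n in atTop, ‖K (kernel p (w n)) - y‖ ≤ η := by
    have := (hK.sub_const y).norm
    rw [sub_self, norm_zero] at this
    exact this.eventually_le_const hη0
  obtain ⟨N, hN, g, hg, hsum⟩ := exists_norm_sum_kernel_le hp1 hlim hP hη0
  have hN0 : (0 : ℝ) < N := by exact_mod_cast hN
  set A := ∑ i ∈ Finset.range N, kernel p (w (g i))
  have h1 : ‖K A - N • y‖ ≤ N * η := by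
    have : K A - N • y = ∑ i ∈ Finset.range N, (K (kernel p (w (g i))) - y) := by
      rw [Finset.sum_sub_distrib, Finset.sum_const, Finset.card_range, map_sum]
    rw [this]
    refine (norm_sum_le_of_le _ fun i _ => hg i).trans_eq ?_
    rw [Finset.sum_const, Finset.card_range, nsmul_eq_mul]
  have h2 : ‖K A‖ ≤ ‖K‖ * (η * N) := (K.le_opNorm A).trans (by gcongr)
  have h3 : ‖N • y‖ = N * ‖y‖ := by rw [← Nat.cast_smul_eq_nsmul ℝ, norm_smul]; simp
  have h4 := norm_sub_norm_le (N • y) (K A)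
  rw [norm_sub_rev, h3] at h4
  have h5 : N * ‖y‖ ≤ N * ε := by
    have : N * ε = N * η + ‖K‖ * (η * N) := by rw [hη]; field_simp
    linarith
  rw [zero_add]
  exact le_of_mul_le_mul_left h5 hN0

lemma tendsto_kernel_apply {w : ℕ → Metric.ball (0 : ℂ) 1}
    (hlim : Tendsto (fun n => ‖(w n : ℂ)‖) atTop (𝓝 1)) {z : ℂ} (hz : z ∈ Metric.ball (0 : ℂ) 1) :
    Tendsto (fun n => ‖kernel p (w n) z‖) atTop (𝓝 0) := by
  have hp0 : 0 < p := pos_exponent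
  have hz1 := mem_ball_zero_iff.1 hz
  have h1 : Tendsto (fun n => ((1 - ‖(w n : ℂ)‖ ^ 2) * (1 - ‖z‖) ^ (-2 : ℝ)) ^ (1 / p)) atTop
      (𝓝 0) := by
    have := (((hlim.pow 2).const_sub 1).mul_const ((1 - ‖z‖) ^ (-2 : ℝ))).rpow_const
      (p := 1 / p) (Or.inr (by positivity))
    rwa [one_pow, sub_self, zero_mul, Real.zero_rpow (by positivity)] at this
  refine squeeze_zero (fun n => norm_nonneg _) (fun n => ?_) h1
  have hwn := mem_ball_zero_iff.1 (w n).2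
  rw [norm_kernel_apply _ hz]
  refine Real.rpow_le_rpow (sqKernel_nonneg hwn z) ?_ (by positivity)
  refine mul_le_mul_of_nonneg_left ?_ (one_sub_norm_sq_pos hwn).le
  refine Real.rpow_le_rpow_of_nonpos (by linarith) ?_ (by norm_num)
  -- The roles of z and w are exchanged by conjugation: the denominator must be bounded below by 1 -
  -- |z|, which is fixed, not by 1 - |w n|.
  have := one_sub_norm_le_norm_one_sub (w := z) (z := w n) hwn.le
  rwa [← Complex.norm_conj (1 - _), map_sub, map_mul, Complex.conj_conj, map_one, mul_comm z]
    at this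

end HardySpace

/-! ### The lower estimates. -/

section WeightedComposition

variable {p : ℝ} [hp : Fact (1 ≤ p)] {u φ : ℂ → ℂ} {T : HardySpace p →L[ℂ] HInfty}

lemma exists_seq_of_lt_weightLimsup (hφ : MapsTo φ (Metric.ball 0 1) (Metric.ball 0 1))
    {c : NNReal} (hc : (c : ℝ≥0∞) < weightLimsup p u φ) :
    ∃ (z : ℕ → ℂ) (w : ℕ → Metric.ball (0 : ℂ) 1), (∀ n, z n ∈ Metric.ball (0 : ℂ) 1) ∧
      (∀ n, w n = φ (z n)) ∧ Tendsto (fun n => ‖(w n : ℂ)‖) atTop (𝓝 1) ∧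
      ∀ n, (c : ℝ) ≤ ‖u (z n)‖ * ‖HardySpace.kernel p (w n) (w n)‖ := by
  have hfr := (frequently_lt_of_lt_limsup (by isBoundedDefault) hc).and_eventually
    (eventually_inf_principal.2 (Eventually.of_forall fun z hz => hz))
  obtain ⟨z, hz, hprop⟩ := exists_seq_forall_of_frequently hfr
  have hlim : Tendsto (fun n => ‖φ (z n)‖) atTop (𝓝 1) :=
    (tendsto_comap (f := fun z => ‖φ z‖)).comp (hz.mono_right inf_le_left)
  refine ⟨z, fun n => ⟨φ (z n), hφ (hprop n).2⟩, fun n => (hprop n).2, fun n => rfl, hlim,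
    fun n => ?_⟩
  have h := (hprop n).1
  rw [← ENNReal.ofReal_coe_nnreal] at h
  rw [HardySpace.norm_kernel_apply_self, ← div_eq_mul_inv]
  exact ((ENNReal.ofReal_lt_ofReal_iff_of_nonneg c.2).1 h).le

lemma exists_subseq_tendsto_apply_kernel {K : HardySpace p →L[ℂ] HInfty}
    (hK : IsCompactOperator K) (w : ℕ → Metric.ball (0 : ℂ) 1) :
    ∃ (y : HInfty) (σ : ℕ → ℕ), StrictMono σ ∧
      Tendsto (fun n => K (HardySpace.kernel p (w (σ n)))) atTop (𝓝 y) := by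
  obtain ⟨S, hS, hKS⟩ := IsCompactOperator.image_closedBall_subset_compact
    (f := (K : HardySpace p →ₗ[ℂ] HInfty)) hK 1
  obtain ⟨y, _, σ, hσ, hy⟩ := hS.tendsto_subseq (x := fun n => K (HardySpace.kernel p (w n)))
    fun n => hKS ⟨_, mem_closedBall_zero_iff.2 (HardySpace.norm_kernel_le_one (w n)), rfl⟩
  exact ⟨y, σ, hσ, hy⟩

/-- The lower estimate of the essential norm for `p > 1`. -/
lemma le_essentialNorm_of_lt_weightLimsup
    (hT : ∀ f : HardySpace p, ∀ z ∈ Metric.ball (0 : ℂ) 1, T f z = u z * f (φ z))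
    (hφ : MapsTo φ (Metric.ball 0 1) (Metric.ball 0 1)) (hp1 : 1 < p) {c : NNReal}
    (hc : (c : ℝ≥0∞) < weightLimsup p u φ) : (c : ℝ) ≤ essentialNorm T := by
  refine le_essentialNorm fun K hK => ?_
  obtain ⟨z, w, hz, hw, hlim, hcz⟩ := exists_seq_of_lt_weightLimsup hφ hc
  obtain ⟨y, σ, hσ, hy⟩ := exists_subseq_tendsto_apply_kernel hK w
  have hlimσ := hlim.comp hσ.tendsto_atTop
  have hy0 := HardySpace.eq_zero_of_tendsto_apply_kernel (w := w ∘ σ) hp1 hlimσ K hy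
  have hlimK : Tendsto (fun n => ‖T - K‖ + ‖K (HardySpace.kernel p (w (σ n)))‖) atTop
      (𝓝 (‖T - K‖ + 0)) := by
    have := hy.norm
    rw [hy0, norm_zero] at this
    exact this.const_add _
  rw [add_zero] at hlimK
  refine ge_of_tendsto hlimK (Eventually.of_forall fun n => ?_)
  set f := HardySpace.kernel p (w (σ n))
  have h1 : (c : ℝ) ≤ ‖T f‖ := by
    refine (hcz (σ n)).trans ?_
    rw [hw, ← norm_mul, ← hT _ _ (hz _)]
    exact HInfty.norm_apply_le _ _
  have h2 : ‖(T - K) f‖ ≤ ‖T - K‖ := (T - K).unit_le_opNorm f (HardySpace.norm_kernel_le_one _)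
  have h3 := norm_add_le ((T - K) f) (K f)
  rw [_root_.sub_apply, sub_add_cancel] at h3
  rw [_root_.sub_apply] at h2
  linarith

/-- The lower estimate of the essential norm for `p ≥ 1`. -/
lemma le_two_mul_essentialNorm_of_lt_weightLimsup
    (hT : ∀ f : HardySpace p, ∀ z ∈ Metric.ball (0 : ℂ) 1, T f z = u z * f (φ z))
    (hφ : MapsTo φ (Metric.ball 0 1) (Metric.ball 0 1)) {c : NNReal}
    (hc : (c : ℝ≥0∞) < weightLimsup p u φ) : (c : ℝ) / 2 ≤ essentialNorm T := by
  refine le_essentialNorm fun K hK => ?_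
  obtain ⟨z, w, hz, hw, hlim, hcz⟩ := exists_seq_of_lt_weightLimsup hφ hc
  obtain ⟨y, σ, hσ, hy⟩ := exists_subseq_tendsto_apply_kernel hK w
  have hlimσ := hlim.comp hσ.tendsto_atTop
  set f : ℕ → HardySpace p := fun n => HardySpace.kernel p (w (σ n))
  -- Evaluate T (f n - f m) at the n-th point ζ and let m → ∞ with n fixed: the value of f m at φ(ζ)
  -- vanishes in the limit and K (f m) becomes y. Only then does n → ∞.
  have key : ∀ n, (c : ℝ) ≤ 2 * ‖T - K‖ + ‖K (f n) - y‖ := fun n => by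
    set ζ := z (σ n)
    have hφζ : φ ζ ∈ Metric.ball (0 : ℂ) 1 := hφ (hz _)
    have hlimm : Tendsto (fun m => ‖u ζ‖ * ‖f m (φ ζ)‖ + 2 * ‖T - K‖ + ‖K (f n) - K (f m)‖) atTop
        (𝓝 (‖u ζ‖ * 0 + 2 * ‖T - K‖ + ‖K (f n) - y‖)) :=
      (((HardySpace.tendsto_kernel_apply (w := w ∘ σ) hlimσ hφζ).const_mul _).add_const _).add
        (hy.const_sub _).norm
    rw [mul_zero, zero_add] at hlimm
    refine ge_of_tendsto hlimm (Eventually.of_forall fun m => ?_)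
    have h1 : (c : ℝ) ≤ ‖T (f n) ζ‖ := by
      rw [hT _ _ (hz _), norm_mul, ← hw]
      exact hcz (σ n)
    have h2 : ‖(T - K) (f n - f m)‖ ≤ ‖T - K‖ * 2 := by
      refine ((T - K).le_opNorm _).trans ?_
      gcongr
      refine (norm_sub_le _ _).trans ?_
      linarith [HardySpace.norm_kernel_le_one (p := p) (w (σ n)),
        HardySpace.norm_kernel_le_one (p := p) (w (σ m))]
    have h3 : ‖T (f n - f m)‖ ≤ ‖T - K‖ * 2 + ‖K (f n) - K (f m)‖ := by
      have := norm_add_le ((T - K) (f n - f m)) (K (f n - f m))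
      rw [_root_.sub_apply, sub_add_cancel] at this
      rw [_root_.sub_apply] at h2
      rw [← map_sub]
      linarith
    have h4 := HInfty.norm_apply_le (T (f n - f m)) ζ
    rw [map_sub, HInfty.sub_apply] at h4
    have h5 := norm_sub_norm_le (T (f n) ζ) (T (f m) ζ)
    have h6 : ‖T (f m) ζ‖ = ‖u ζ‖ * ‖f m (φ ζ)‖ := by rw [hT _ _ (hz _), norm_mul]
    rw [map_sub] at h3
    linarith
  have hlimn : Tendsto (fun n => 2 * ‖T - K‖ + ‖K (f n) - y‖) atTop (𝓝 (2 * ‖T - K‖ + 0)) := by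
    have := (hy.sub_const y).norm
    rw [sub_self, norm_zero] at this
    exact this.const_add _
  have := ge_of_tendsto hlimn (Eventually.of_forall key)
  linarith

end WeightedComposition

theorem mainTheorem2 (p : ℝ) [Fact (1 ≤ p)] (u φ : ℂ → ℂ)
    (hu : DifferentiableOn ℂ u (Metric.ball 0 1))
    (hφ : DifferentiableOn ℂ φ (Metric.ball 0 1))
    (hφmaps : MapsTo φ (Metric.ball 0 1) (Metric.ball 0 1))
    (hφnorm : diskSupNorm φ = 1)
    (T : HardySpace p →L[ℂ] HInfty)
    (hT : ∀ f : HardySpace p, ∀ z ∈ Metric.ball (0 : ℂ) 1, T f z = u z * f (φ z)) :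
    (1 / 2) * weightLimsup p u φ ≤ ENNReal.ofReal (essentialNorm T) ∧
    ENNReal.ofReal (essentialNorm T) ≤ 2 * weightLimsup p u φ ∧
    (1 < p → weightLimsup p u φ ≤ ENNReal.ofReal (essentialNorm T)) := by
  refine ⟨?_, essentialNorm_le_two_mul_weightLimsup hT hφmaps, fun hp1 => ?_⟩
  · rw [mul_comm, ← ENNReal.le_div_iff_mul_le (by simp) (by simp)]
    -- Testing against finite c below the limsup also rules out an infinite limsup.
    refine ENNReal.le_of_forall_nnreal_lt fun c hc => ?_
    rw [ENNReal.le_div_iff_mul_le (by simp) (by simp)]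
    have h := le_two_mul_essentialNorm_of_lt_weightLimsup hT hφmaps hc
    refine le_of_eq_of_le ?_ (ENNReal.ofReal_le_ofReal h)
    rw [ENNReal.ofReal_div_of_pos two_pos, ENNReal.ofReal_coe_nnreal, ENNReal.ofReal_ofNat,
      one_div, div_eq_mul_inv]
  · refine ENNReal.le_of_forall_nnreal_lt fun c hc => ?_
    rw [← ENNReal.ofReal_coe_nnreal]
    exact ENNReal.ofReal_le_ofReal (le_essentialNorm_of_lt_weightLimsup hT hφmaps hp1 hc)
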